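/- Let $H:[0,\infty)\to[0,1]$ be Borel measurable with $\|H\|_1=\int_0^\infty H(r)\,dr<\infty$, and let $\gamma>0$. For $L>1$ put $R_L=\gamma\ln L$ and consider the soft random geometric graph on the circle of length $L$, that is, the interval $[0,L]$ with its endpoints identified, with circular distance $\rho$: the nodes are the points of a Poisson point process of unit intensity on the circle and, given the nodes, each pair of distinct nodes $x,y$ is joined by an edge with probability $h^L(x,y)=H(\rho(x,y)/R_L)$, independently of all other pairs. A node is isolated if it is joined to no other node; let $N_{\mathrm{iso}}$ be the number of isolated nodes. Then $$\lim_{L\to\infty}\mathbb P(N_{\mathrm{iso}}=0)=\begin{cases}0,&\text{if }2\gamma\|H\|_1<1,\\ 1,&\text{if }2\gamma\|H\|_1>1.\end{cases}$$ Moreover, the mean degree $d_L$ of the graph (the expected sum of the degrees of all nodes, divided by the expected number of nodes) equals $\int_0^L h^L(0,z)\,dz$ for every $L>1$, and $d_L/\ln L\to 2\gamma\|H\|_1$ as $L\to\infty$; thus the threshold is at mean degree $\ln L$. -/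

import Mathlib

open MeasureTheory ProbabilityTheory Filter Topology
open scoped NNReal ENNReal

/-- The number of points of the finite configuration `V` that lie in `B`. -/
noncomputable def pointCount {E : Type*} (V : Finset E) (B : Set E) : ℕ :=
  ((V : Set E) ∩ B).ncard

/-- The random finite set `V` is a Poisson point process with (finite) intensity measure `ν`:
the number of points in a Borel set `B` is a Poisson random variable with mean `ν B`, and
the numbers of points in pairwise disjoint sets are mutually independent. -/
structure IsPoissonProcess {Ω E : Type*} [MeasurableSpace Ω] [MeasurableSpace E]
    (P : Measure Ω) (ν : Measure E) [IsFiniteMeasure ν] (V : Ω → Finset E) : Prop where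
  measurable_count : ∀ B : Set E, MeasurableSet B → Measurable fun ω => pointCount (V ω) B
  law_count : ∀ B : Set E, MeasurableSet B →
    HasLaw (fun ω => pointCount (V ω) B) (poissonMeasure (ν B).toNNReal) P
  indep_count : ∀ (k : ℕ) (B : Fin k → Set E), (∀ i, MeasurableSet (B i)) →
    Pairwise (fun i j => Disjoint (B i) (B j)) →
    iIndepFun (fun i ω => pointCount (V ω) (B i)) P

open Classical in
/-- The probability of the labelled graph `g` on points `x 0, …, x (n - 1)` when the pairs of points
are joined independently, the pair `x i`, `x j` with probability `h (x i) (x j)`. -/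
noncomputable def graphProb {E : Type*} (h : E → E → ℝ) {n : ℕ} (x : Fin n → E)
    (g : SimpleGraph (Fin n)) : ℝ :=
  ∏ p : Fin n × Fin n with p.1 < p.2,
    if g.Adj p.1 p.2 then h (x p.1) (x p.2) else 1 - h (x p.1) (x p.2)

/-- The points of `V` are enumerated without repetition as `X 0, X 1, …, X (#V - 1)`, measurably,
and, conditionally on the enumerated configuration, distinct points `x`, `y` of `V` are joined in `G`
with probability `h x y`, independently for different pairs.  The conditional law of the graph is
expressed by integrating over arbitrary events of the configuration.  Only the edges of `G` between
points of `V` play a role. -/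
structure HasIndependentEdges {Ω E : Type*} [MeasurableSpace Ω] [MeasurableSpace E]
    (P : Measure Ω) (h : E → E → ℝ) (V : Ω → Finset E) (G : Ω → SimpleGraph E)
    (X : ℕ → Ω → E) : Prop where
  measurable_enum : ∀ i, Measurable (X i)
  bijOn_enum : ∀ ω, Set.BijOn (fun i => X i ω) (Set.Iio (V ω).card) (V ω : Set E)
  measurableSet_graph : ∀ (n : ℕ) (g : SimpleGraph (Fin n)), MeasurableSet
    {ω | (V ω).card = n ∧ ∀ i j : Fin n, (G ω).Adj (X i ω) (X j ω) ↔ g.Adj i j}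
  law_graph : ∀ (n : ℕ) (g : SimpleGraph (Fin n)) (S : Set (Fin n → E)), MeasurableSet S →
    P ({ω | (V ω).card = n ∧ (fun i : Fin n => X i ω) ∈ S} ∩
        {ω | (V ω).card = n ∧ ∀ i j : Fin n, (G ω).Adj (X i ω) (X j ω) ↔ g.Adj i j}) =
      ∫⁻ ω in {ω | (V ω).card = n ∧ (fun i : Fin n => X i ω) ∈ S},
        ENNReal.ofReal (graphProb h (fun i : Fin n => X i ω) g) ∂P

/-- A soft random geometric graph on the circle `ℝ / Lℤ` of length `L`: the node set `V` is a Poisson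
process of unit intensity, and, given the nodes, pairs of nodes `x`, `y` are joined
independently with probability `h x y`. -/
structure IsSoftRGG {Ω : Type*} [MeasurableSpace Ω] (P : Measure Ω) (L : ℝ) [Fact (0 < L)]
    (h : AddCircle L → AddCircle L → ℝ) (V : Ω → Finset (AddCircle L))
    (G : Ω → SimpleGraph (AddCircle L)) : Prop where
  poisson : IsPoissonProcess P (volume : Measure (AddCircle L)) V
  edges : ∃ X : ℕ → Ω → AddCircle L, HasIndependentEdges P h V G X

/-- The connection probability `H (ρ(x, y) / R)`, where `ρ(x, y) = ‖x - y‖` is the circular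
distance on the circle of length `L`. -/
noncomputable def scaledConnection (H : ℝ → ℝ) (R L : ℝ) (x y : AddCircle L) : ℝ :=
  H (‖x - y‖ / R)

/-- The number of isolated nodes: points of `V` not joined by an edge to any other point of `V`. -/
noncomputable def numIsolated {E : Type*} (V : Finset E) (G : SimpleGraph E) : ℕ :=
  {x : E | x ∈ V ∧ ∀ y ∈ V, y ≠ x → ¬ G.Adj x y}.ncard

/-- The mean degree: the expected sum of the degrees of all nodes divided by the expected number of
nodes. -/
noncomputable def meanDegree {Ω E : Type*} [MeasurableSpace Ω] (P : Measure Ω)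
    (V : Ω → Finset E) (G : Ω → SimpleGraph E) : ℝ≥0∞ :=
  (∫⁻ ω, ((∑ x ∈ V ω, {y : E | y ∈ V ω ∧ (G ω).Adj x y}.ncard : ℕ) : ℝ≥0∞) ∂P) /
    ∫⁻ ω, ((V ω).card : ℝ≥0∞) ∂P

/-! ### Poisson processes: the law of the enumerated points. -/

section PointProcess

/-! Put d = ∫ h(0, z) dz, which by translation invariance is the mean number of neighbours of a node
at any place, and κ = 2γ‖H‖₁. A node has no neighbour with probability exp(-d), so the number N of
isolated nodes has mean M = L exp(-d). Rescaling the circle shows d / ln L → κ, hence M = L^(1 - κ +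
o(1)).

If κ > 1, then M → 0 and Markov's inequality gives P(N = 0) → 1. If κ < 1, the second moment method
applies. Nodes at a and b are both isolated with probability (1 - h(a, b)) exp(-2d + c), where c =
c(a, b) is the mean number of common neighbours. Since c ≤ d, convexity-type bounds give exp(c) ≤ 1
+ c exp(d), and ∬ c = L d², so E N(N - 1) ≤ M² + M d². Then E (N - M)² ≤ M (1 + d²), and P(N = 0) ≤
(1 + d²) / M. This tends to 0 because d is only logarithmic in L.

The exact moments rest on two facts. By `IsPoissonProcess.sum_map_enum`, on the event of n points
the law of the configuration, summed over orderings, is exp(-ν(E)) times the n-fold product of ν. By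
`sum_simpleGraph_pairProd`, summing a product weight over all graphs factorizes over pairs, so
conditional expectations given the nodes are explicit symmetric functions.
`HasIndependentEdges.lintegral_eq_tsum` combines them, and the sum over n is an exponential series.
The estimates are `lintegral_pair_correlation_le` and the two moment bounds that follow it. -/

theorem pointCount_univ {E : Type*} (W : Finset E) : pointCount W Set.univ = W.card := by
  simp [pointCount]

/-- The enumeration order of the points is arbitrary, so counts reveal the enumerated tuple only up
to a permutation: σ records which index belongs to the point in each `B i`. This is the bridge from
counts, on which the Poisson axioms speak, to tuples. -/
theorem one_in_each_eq_iUnion {Ω E : Type*} {V : Ω → Finset E} {X : ℕ → Ω → E}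
    (hX : ∀ ω, Set.BijOn (fun i => X i ω) (Set.Iio (V ω).card) (V ω))
    {n : ℕ} (B : Fin n → Set E) (hd : Pairwise fun i j => Disjoint (B i) (B j)) :
    {ω | pointCount (V ω) (⋃ i, B i)ᶜ = 0 ∧ ∀ i, pointCount (V ω) (B i) = 1} =
      ⋃ σ : Equiv.Perm (Fin n), {ω | (V ω).card = n ∧ ∀ i, X (σ i) ω ∈ B i} := by
  ext ω
  have hfin : ∀ A : Set E, ((V ω : Set E) ∩ A).Finite := fun A =>
    (V ω).finite_toSet.subset Set.inter_subset_left
  simp only [Set.mem_ofPred_eq, Set.mem_iUnion, pointCount, Set.ncard_eq_zero (hfin _),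
    Set.ncard_eq_one]
  constructor
  · rintro ⟨h0, h1⟩
    choose x hx using h1
    have hxV : ∀ i, x i ∈ V ω ∧ x i ∈ B i := fun i => by
      have : x i ∈ (V ω : Set E) ∩ B i := by rw [hx i]; rfl
      exact ⟨by simpa using this.1, this.2⟩
    have hxinj : Function.Injective x := fun i j hij => by
      by_contra hne
      exact Set.disjoint_left.1 (hd hne) (hxV i).2 (hij ▸ (hxV j).2)
    have hVx : V ω = Finset.univ.map ⟨x, hxinj⟩ := by
      ext y
      simp only [Finset.mem_map, Finset.mem_univ, true_and, Function.Embedding.coeFn_mk]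
      constructor
      · intro hy
        have hyB : y ∈ ⋃ i, B i := by
          by_contra hn
          have : y ∈ (V ω : Set E) ∩ (⋃ i, B i)ᶜ := ⟨by simpa using hy, hn⟩
          rw [h0] at this; exact this
        obtain ⟨i, hi⟩ := Set.mem_iUnion.1 hyB
        have : y ∈ (V ω : Set E) ∩ B i := ⟨by simpa using hy, hi⟩
        rw [hx i] at this
        exact ⟨i, this.symm⟩
      · rintro ⟨i, rfl⟩; exact (hxV i).1
    have hcard : (V ω).card = n := by rw [hVx]; simp
    have hτ : ∀ i, ∃ j : Fin n, X j ω = x i := fun i => by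
      obtain ⟨j, hj, hje⟩ := (hX ω).surjOn (show x i ∈ (V ω : Set E) by simpa using (hxV i).1)
      exact ⟨⟨j, by simpa [hcard] using hj⟩, hje⟩
    choose τ hτ using hτ
    have hinj : Function.Injective τ := fun i j hij => hxinj (by rw [← hτ i, ← hτ j, hij])
    refine ⟨Equiv.ofBijective τ (Finite.injective_iff_bijective.1 hinj), hcard, fun i => ?_⟩
    simpa [hτ i] using (hxV i).2
  · rintro ⟨σ, hcard, hσ⟩
    have key : ∀ y ∈ V ω, ∃ i : Fin n, y = X (σ i) ω := fun y hy => by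
      obtain ⟨j, hj, hje⟩ := (hX ω).surjOn (show y ∈ (V ω : Set E) by simpa using hy)
      have hj' : j < n := by simpa [hcard] using hj
      exact ⟨σ.symm ⟨j, hj'⟩, by simpa using hje.symm⟩
    have hmem : ∀ i : Fin n, X (σ i) ω ∈ (V ω : Set E) := fun i =>
      (hX ω).mapsTo (show ((σ i : Fin n) : ℕ) ∈ Set.Iio (V ω).card by
        rw [hcard]; exact (σ i).2)
    refine ⟨?_, fun i => ⟨X (σ i) ω, ?_⟩⟩
    · rw [Set.eq_empty_iff_forall_notMem]
      rintro y ⟨hy, hyB⟩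
      obtain ⟨i, rfl⟩ := key y (by simpa using hy)
      exact hyB (Set.mem_iUnion.2 ⟨i, hσ i⟩)
    · ext y
      constructor
      · rintro ⟨hy, hyB⟩
        obtain ⟨j, rfl⟩ := key y (by simpa using hy)
        by_cases hij : j = i
        · rw [hij]; rfl
        · exact (Set.disjoint_left.1 (hd hij) (hσ j) hyB).elim
      · rintro rfl; exact ⟨hmem i, hσ i⟩

variable {Ω E : Type*} [MeasurableSpace Ω] [MeasurableSpace E]
  {P : Measure Ω} {ν : Measure E} [IsFiniteMeasure ν] {V : Ω → Finset E} {X : ℕ → Ω → E}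

theorem IsPoissonProcess.measurableSet_card (hV : IsPoissonProcess P ν V) (n : ℕ) :
    MeasurableSet {ω | (V ω).card = n} := by
  have := hV.measurable_count Set.univ MeasurableSet.univ (measurableSet_singleton n)
  simpa [Set.preimage, pointCount_univ] using this

theorem IsPoissonProcess.measure_card_eq (hV : IsPoissonProcess P ν V) (n : ℕ) :
    P {ω | (V ω).card = n} =
      ENNReal.ofReal (Real.exp (-ν.real Set.univ) * ν.real Set.univ ^ n / n.factorial) := by
  have := (hV.law_count Set.univ MeasurableSet.univ).measure_eq (p := fun k => k = n)
    (measurableSet_singleton n)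
  simp only [pointCount_univ, Set.ofPred_eq_eq_singleton, poissonMeasure_singleton] at this
  rw [this]; rfl

theorem IsPoissonProcess.measure_count_eq_zero (hV : IsPoissonProcess P ν V) {B : Set E}
    (hB : MeasurableSet B) :
    P {ω | pointCount (V ω) B = 0} = ENNReal.ofReal (Real.exp (-ν.real B)) := by
  have := (hV.law_count B hB).measure_eq (p := fun k => k = 0) (measurableSet_singleton 0)
  simp only [Set.ofPred_eq_eq_singleton, poissonMeasure_singleton] at this
  rw [this]; simp [Measure.real, ENNReal.toReal]

theorem IsPoissonProcess.measure_count_eq_one (hV : IsPoissonProcess P ν V) {B : Set E}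
    (hB : MeasurableSet B) :
    P {ω | pointCount (V ω) B = 1} = ENNReal.ofReal (Real.exp (-ν.real B)) * ν B := by
  have := (hV.law_count B hB).measure_eq (p := fun k => k = 1) (measurableSet_singleton 1)
  simp only [Set.ofPred_eq_eq_singleton, poissonMeasure_singleton] at this
  rw [this, ← ENNReal.ofReal_toReal (measure_ne_top ν B), ← ENNReal.ofReal_mul (by positivity)]
  simp [Measure.real, ENNReal.toReal]

/-- The probability that there is exactly one point in each of the disjoint sets `B i`, and no point
elsewhere. -/
theorem IsPoissonProcess.measure_one_in_each (hV : IsPoissonProcess P ν V) {n : ℕ}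
    (B : Fin n → Set E) (hB : ∀ i, MeasurableSet (B i))
    (hd : Pairwise fun i j => Disjoint (B i) (B j)) :
    P {ω | pointCount (V ω) (⋃ i, B i)ᶜ = 0 ∧ ∀ i, pointCount (V ω) (B i) = 1} =
      ENNReal.ofReal (Real.exp (-ν.real Set.univ)) * ∏ i, ν (B i) := by
  have hU : MeasurableSet (⋃ i, B i) := MeasurableSet.iUnion hB
  -- Adjoining the complement as one more disjoint set lets a single use of independence cover the
  -- whole event.
  let C : Fin (n + 1) → Set E := Fin.cons (⋃ i, B i)ᶜ B
  have hC : ∀ i, MeasurableSet (C i) := by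
    intro i; refine Fin.cases hU.compl (fun i => hB i) i
  have hsub : ∀ i, Disjoint (⋃ i, B i)ᶜ (B i) := fun i =>
    Set.disjoint_compl_left_iff_subset.2 (Set.subset_iUnion B i)
  have hCd : Pairwise fun i j => Disjoint (C i) (C j) := by
    intro i j
    refine Fin.cases ?_ (fun i => ?_) i <;> refine Fin.cases ?_ (fun j => ?_) j
    · simp
    · intro _; exact hsub j
    · intro _; exact (hsub i).symm
    · intro h; exact hd (ne_of_apply_ne Fin.succ h)
  let k : Fin (n + 1) → ℕ := Fin.cons 0 fun _ => 1
  have h := (hV.indep_count (n + 1) C hC hCd).measure_inter_preimage_eq_mul Finset.univ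
    (sets := fun i => {k i}) (fun i _ => measurableSet_singleton _)
  rw [Fin.prod_univ_succ] at h
  have e1 : (⋂ i ∈ (Finset.univ : Finset (Fin (n + 1))),
      (fun ω => pointCount (V ω) (C i)) ⁻¹' {k i}) =
      {ω | pointCount (V ω) (⋃ i, B i)ᶜ = 0 ∧ ∀ i, pointCount (V ω) (B i) = 1} := by
    ext ω; simp [Fin.forall_fin_succ, C, k]
  rw [e1] at h
  rw [h]
  have e2 : P ((fun ω => pointCount (V ω) (C 0)) ⁻¹' {k 0}) =
      ENNReal.ofReal (Real.exp (-ν.real (⋃ i, B i)ᶜ)) :=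
    hV.measure_count_eq_zero hU.compl
  have e3 : ∀ i : Fin n, P ((fun ω => pointCount (V ω) (C i.succ)) ⁻¹' {k i.succ}) =
      ENNReal.ofReal (Real.exp (-ν.real (B i))) * ν (B i) := fun i =>
    hV.measure_count_eq_one (hB i)
  rw [e2, Finset.prod_congr rfl fun i _ => e3 i, Finset.prod_mul_distrib, ← mul_assoc,
    ← ENNReal.ofReal_prod_of_nonneg (fun i _ => by positivity),
    ← ENNReal.ofReal_mul (by positivity), ← Real.exp_sum, ← Real.exp_add]
  congr 4
  rw [Finset.sum_neg_distrib, ← neg_add, ← measureReal_iUnion_fintype hd hB,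
    add_comm, measureReal_add_measureReal_compl hU]

variable [TopologicalSpace E] [T2Space E] [SecondCountableTopology E] [BorelSpace E]

/-- Tuples of distinct points are covered by countably many boxes with disjoint sides. -/
theorem exists_countable_cover_injective (n : ℕ) :
    ∃ (ι : Type) (_ : Countable ι) (B : ι → Fin n → Set E),
      (∀ s i, MeasurableSet (B s i)) ∧
      (∀ s, Pairwise fun i j => Disjoint (B s i) (B s j)) ∧
      {x : Fin n → E | Function.Injective x} ⊆ ⋃ s, Set.univ.pi (B s) := by
  classical
  let b := TopologicalSpace.countableBasis E
  have hb := TopologicalSpace.isBasis_countableBasis E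
  have : Countable b := (TopologicalSpace.countable_countableBasis E).to_subtype
  let T := {s : Fin n → b // Pairwise fun i j => Disjoint (s i : Set E) (s j)}
  -- `T` lives in the universe of `E`; its image in ℕ provides an index set in `Type`.
  obtain ⟨e, he⟩ := exists_injective_nat T
  refine ⟨Set.range e, inferInstance, fun s i => ((Equiv.ofInjective e he).symm s).1 i, ?_, ?_, ?_⟩
  · intro s i
    exact (hb.isOpen (((Equiv.ofInjective e he).symm s).1 i).2).measurableSet
  · intro s; exact ((Equiv.ofInjective e he).symm s).2
  · intro x hx
    obtain ⟨U, hU, hUd⟩ := (Set.finite_range x).t2_separation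
    have hc : ∀ i, ∃ u : b, x i ∈ (u : Set E) ∧ (u : Set E) ⊆ U (x i) := fun i => by
      obtain ⟨u, hu, hxu, huU⟩ := hb.exists_subset_of_mem_open (hU (x i)).1 (hU (x i)).2
      exact ⟨⟨u, hu⟩, hxu, huU⟩
    choose u hxu huU using hc
    have hud : Pairwise fun i j => Disjoint (u i : Set E) (u j) := fun i j hij =>
      (hUd ⟨i, rfl⟩ ⟨j, rfl⟩ (hx.ne hij)).mono (huU i) (huU j)
    refine Set.mem_iUnion.2 ⟨Equiv.ofInjective e he ⟨u, hud⟩, fun i _ => ?_⟩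
    simpa using hxu i

/-- The law of the points of a Poisson process on the event that there are `n` points, summed over all
enumerations, is the `n`-fold product of the intensity, up to a constant. -/
theorem IsPoissonProcess.sum_map_enum (hV : IsPoissonProcess P ν V)
    (hXm : ∀ i, Measurable (X i))
    (hX : ∀ ω, Set.BijOn (fun i => X i ω) (Set.Iio (V ω).card) (V ω)) (n : ℕ) :
    ∑ σ : Equiv.Perm (Fin n),
        (P.restrict {ω | (V ω).card = n}).map (fun ω i => X (σ i) ω) =
      ENNReal.ofReal (Real.exp (-ν.real Set.univ)) • Measure.pi fun _ : Fin n => ν := by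
  set μ := ∑ σ : Equiv.Perm (Fin n),
        (P.restrict {ω | (V ω).card = n}).map (fun ω i => X (σ i) ω) with hμ
  set c := ENNReal.ofReal (Real.exp (-ν.real Set.univ)) with hc
  have hc0 : c ≠ ⊤ := ENNReal.ofReal_ne_top
  have hm : ∀ σ : Equiv.Perm (Fin n), Measurable fun ω i => X (σ i) ω := fun σ =>
    measurable_pi_lambda _ fun i => hXm _
  have hA := hV.measurableSet_card n
  have hμS : ∀ S, MeasurableSet S → μ S =
      ∑ σ : Equiv.Perm (Fin n), P {ω | (V ω).card = n ∧ (fun i => X (σ i) ω) ∈ S} := by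
    intro S hS
    rw [hμ, Measure.coe_finsetSum, Finset.sum_apply]
    refine Finset.sum_congr rfl fun σ _ => ?_
    rw [Measure.map_apply (hm σ) hS, Measure.restrict_apply (hm σ hS)]
    congr 1; ext ω; simp [and_comm]
  have hbox : ∀ B : Fin n → Set E, (∀ i, MeasurableSet (B i)) →
      (Pairwise fun i j => Disjoint (B i) (B j)) →
      μ (Set.univ.pi B) = c * ∏ i, ν (B i) := by
    intro B hB hd
    rw [hμS _ (MeasurableSet.univ_pi hB), ← hV.measure_one_in_each B hB hd,
      one_in_each_eq_iUnion hX B hd, measure_iUnion, tsum_fintype]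
    · simp
    -- If both orderings are possible and differ at i, then the point with index σ i lies in two
    -- disjoint sets.
    · intro σ τ hστ
      rw [Function.onFun, Set.disjoint_left]
      rintro ω ⟨hn, h1⟩ ⟨_, h2⟩
      refine hστ (Equiv.ext fun i => ?_)
      obtain ⟨j, hj⟩ := τ.surjective (σ i)
      by_cases hij : i = j
      · rw [← hj, hij]
      · have := h2 j
        rw [hj] at this
        exact (Set.disjoint_left.1 (hd hij) (h1 i) this).elim
    · intro σ
      have := hA.inter ((hm σ) (MeasurableSet.univ_pi hB))
      convert this using 1
      ext ω; simp
  -- The n! orderings cancel the n! of the Poisson weight.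
  have hmass : μ Set.univ = (c • Measure.pi fun _ : Fin n => ν) Set.univ := by
    rw [hμS _ MeasurableSet.univ]
    simp only [Set.mem_univ, and_true, Finset.sum_const, Finset.card_univ, Fintype.card_perm,
      Fintype.card_fin, Measure.smul_apply, Measure.pi_univ, Finset.prod_const, nsmul_eq_mul,
      smul_eq_mul]
    rw [hV.measure_card_eq, hc, ← ENNReal.ofReal_toReal (measure_ne_top ν Set.univ),
      ← ENNReal.ofReal_pow ENNReal.toReal_nonneg, ← ENNReal.ofReal_mul (by positivity),
      ← ENNReal.ofReal_natCast, ← ENNReal.ofReal_mul (by positivity)]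
    congr 1
    have : (n.factorial : ℝ) ≠ 0 := by positivity
    simp only [Measure.real]
    field_simp
  have : IsFiniteMeasure (c • Measure.pi fun _ : Fin n => ν) := Measure.smul_finite _ hc0
  have : IsFiniteMeasure μ := ⟨by rw [hmass]; exact measure_lt_top _ _⟩
  obtain ⟨ι, _, B, hB, hd, hcov⟩ := exists_countable_cover_injective (E := E) n
  have hres : μ.restrict (⋃ s, Set.univ.pi (B s)) =
      (c • Measure.pi fun _ : Fin n => ν).restrict (⋃ s, Set.univ.pi (B s)) := by
    rw [Measure.restrict_iUnion_congr]
    intro s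
    have hpi : MeasurableSet (Set.univ.pi (B s)) := MeasurableSet.univ_pi (hB s)
    -- Intersecting any box with one of disjoint sides again gives a box of disjoint sides, so
    -- `hbox` decides a whole π-system.
    have hgen : ∀ D : Fin n → Set E, (∀ i, MeasurableSet (D i)) →
        μ.restrict (Set.univ.pi (B s)) (Set.univ.pi D) =
        (c • Measure.pi fun _ : Fin n => ν).restrict (Set.univ.pi (B s)) (Set.univ.pi D) := by
      intro D hD
      rw [Measure.restrict_apply (MeasurableSet.univ_pi hD),
        Measure.restrict_apply (MeasurableSet.univ_pi hD), ← Set.pi_inter_distrib,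
        hbox _ (fun i => (hD i).inter (hB s i)), Measure.smul_apply, Measure.pi_pi, smul_eq_mul]
      intro i j hij
      exact (hd s hij).mono Set.inter_subset_right Set.inter_subset_right
    refine ext_of_generate_finite _ generateFrom_pi.symm isPiSystem_pi ?_ ?_
    · rintro _ ⟨D, hD, rfl⟩
      exact hgen D fun i => hD i (Set.mem_univ i)
    · have := hgen (fun _ => Set.univ) fun _ => MeasurableSet.univ
      simpa using this
  have hUm : MeasurableSet (⋃ s, Set.univ.pi (B s)) :=
    MeasurableSet.iUnion fun s => MeasurableSet.univ_pi (hB s)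
  have hnull : μ (⋃ s, Set.univ.pi (B s))ᶜ = 0 := by
    rw [hμS _ hUm.compl]
    refine Finset.sum_eq_zero fun σ _ => ?_
    convert measure_empty (μ := P)
    rw [Set.eq_empty_iff_forall_notMem]
    rintro ω ⟨hn, hω⟩
    refine hω (hcov fun i j hij => ?_)
    have := (hX ω).injOn (show ((σ i : Fin n) : ℕ) ∈ Set.Iio (V ω).card by rw [hn]; exact (σ i).2)
      (show ((σ j : Fin n) : ℕ) ∈ Set.Iio (V ω).card by rw [hn]; exact (σ j).2) hij
    exact σ.injective (Fin.ext this)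
  have hU : μ (⋃ s, Set.univ.pi (B s)) =
      (c • Measure.pi fun _ : Fin n => ν) (⋃ s, Set.univ.pi (B s)) := by
    have := congrArg (fun m : Measure (Fin n → E) => m Set.univ) hres
    simpa only [Measure.restrict_apply_univ] using this
  -- That ν has no atoms is not assumed. The two measures have equal total mass and agree on the
  -- covered part, and μ vanishes off it, so the product measure must vanish there too.
  have hnull' : (c • Measure.pi fun _ : Fin n => ν) (⋃ s, Set.univ.pi (B s))ᶜ = 0 := by
    rw [measure_compl hUm (measure_ne_top _ _), ← hU, ← hmass,
      ← measure_compl hUm (measure_ne_top _ _), hnull]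
  calc μ = μ.restrict (⋃ s, Set.univ.pi (B s)) := by
        conv_lhs => rw [← Measure.restrict_add_restrict_compl (μ := μ) hUm,
          Measure.restrict_eq_zero.2 hnull, add_zero]
    _ = (c • Measure.pi fun _ : Fin n => ν).restrict (⋃ s, Set.univ.pi (B s)) := hres
    _ = c • Measure.pi fun _ : Fin n => ν := by
        conv_rhs => rw [← Measure.restrict_add_restrict_compl
          (μ := c • Measure.pi fun _ : Fin n => ν) hUm, Measure.restrict_eq_zero.2 hnull', add_zero]

/-- For a symmetric integrand all n! orderings in `IsPoissonProcess.sum_map_enum` contribute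
equally, so the unknown enumeration drops out. -/
theorem IsPoissonProcess.lintegral_enum (hV : IsPoissonProcess P ν V)
    (hXm : ∀ i, Measurable (X i))
    (hX : ∀ ω, Set.BijOn (fun i => X i ω) (Set.Iio (V ω).card) (V ω)) {n : ℕ}
    {f : (Fin n → E) → ℝ≥0∞} (hf : Measurable f)
    (hsymm : ∀ (σ : Equiv.Perm (Fin n)) x, f (x ∘ σ) = f x) :
    ∫⁻ ω in {ω | (V ω).card = n}, f (fun i => X i ω) ∂P =
      ENNReal.ofReal (Real.exp (-ν.real Set.univ)) / n.factorial *
        ∫⁻ x, f x ∂Measure.pi fun _ => ν := by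
  have h := congrArg (fun m => ∫⁻ x, f x ∂m) (hV.sum_map_enum hXm hX n)
  simp only [lintegral_smul_measure, lintegral_finsetSum_measure, smul_eq_mul] at h
  have e : ∀ σ : Equiv.Perm (Fin n),
      ∫⁻ x, f x ∂(P.restrict {ω | (V ω).card = n}).map (fun ω i => X (σ i) ω) =
        ∫⁻ ω in {ω | (V ω).card = n}, f (fun i => X i ω) ∂P := fun σ => by
    rw [lintegral_map hf (measurable_pi_lambda _ fun i => hXm _)]
    exact lintegral_congr fun ω => hsymm σ fun i => X i ω
  simp only [e, Finset.sum_const, Finset.card_univ, Fintype.card_perm, Fintype.card_fin,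
    nsmul_eq_mul] at h
  have h0 : (n.factorial : ℝ≥0∞) ≠ 0 := by exact_mod_cast n.factorial_ne_zero
  rw [div_eq_mul_inv, mul_right_comm, ← h, mul_comm, ← mul_assoc,
    ENNReal.inv_mul_cancel h0 (ENNReal.natCast_ne_top _), one_mul]

end PointProcess

/-! ### Sums over graphs of products over pairs. -/

section PairProducts

/-- The product of `u a b` over the pairs `a < b`. -/
noncomputable def pairProd {n : ℕ} (u : Fin n → Fin n → ℝ≥0∞) : ℝ≥0∞ :=
  ∏ p : Fin n × Fin n with p.1 < p.2, u p.1 p.2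

theorem pairProd_congr {n : ℕ} {u v : Fin n → Fin n → ℝ≥0∞} (h : ∀ a b, a ≠ b → u a b = v a b) :
    pairProd u = pairProd v :=
  Finset.prod_congr rfl fun _ hp => h _ _ (Finset.mem_filter.1 hp).2.ne

theorem pairProd_one {n : ℕ} : pairProd (fun _ _ : Fin n => 1) = 1 := by simp [pairProd]

/-- Splitting off the pairs that contain a given index. -/
theorem pairProd_succAbove {n : ℕ} (u : Fin (n + 1) → Fin (n + 1) → ℝ≥0∞)
    (hu : ∀ a b, u a b = u b a) (i : Fin (n + 1)) :
    pairProd u = (∏ k, u i (i.succAbove k)) *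
      pairProd fun a b => u (i.succAbove a) (i.succAbove b) := by
  simp only [pairProd, Finset.prod_filter, Fintype.prod_prod_type]
  rw [Fin.prod_univ_succAbove _ i, Fin.prod_univ_succAbove _ i]
  simp only [lt_irrefl, if_false, one_mul]
  have : ∀ a : Fin n, (∏ b, if i.succAbove a < b then u (i.succAbove a) b else 1) =
      (if i.succAbove a < i then u i (i.succAbove a) else 1) *
        ∏ b, if a < b then u (i.succAbove a) (i.succAbove b) else 1 := fun a => by
    rw [Fin.prod_univ_succAbove _ i, hu]
    simp [(Fin.strictMono_succAbove i).lt_iff_lt]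
  simp only [this, Finset.prod_mul_distrib]
  rw [← mul_assoc, ← Finset.prod_mul_distrib]
  congr 1
  refine Finset.prod_congr rfl fun k _ => ?_
  rcases lt_or_gt_of_ne (Fin.succAbove_ne i k) with h | h
  · simp [h, h.le]
  · simp [h, h.le]

open Classical in
-- A graph on `Fin n` is a subset of the pairs a < b, so this is the expansion of a product of sums.
theorem sum_simpleGraph_pairProd {n : ℕ} (u v : Fin n → Fin n → ℝ≥0∞) :
    ∑ g : SimpleGraph (Fin n), pairProd (fun a b => if g.Adj a b then u a b else v a b) =
      pairProd fun a b => u a b + v a b := by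
  rw [pairProd, Finset.prod_add]
  set s : Finset (Fin n × Fin n) := Finset.univ.filter fun p => p.1 < p.2 with hs
  refine Finset.sum_bij' (fun g _ => s.filter fun p => g.Adj p.1 p.2)
    (fun t _ => SimpleGraph.fromRel fun a b => (a, b) ∈ t) ?_ ?_ ?_ ?_ ?_
  · intro g _; simp
  · intro t _; simp
  · intro g _
    ext a b
    simp only [SimpleGraph.fromRel_adj, Finset.mem_filter, hs, Finset.mem_univ, true_and]
    constructor
    · rintro ⟨_, h | h⟩
      · exact h.2
      · exact h.2.symm
    · intro h
      rcases lt_or_gt_of_ne h.ne with h' | h'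
      · exact ⟨h.ne, Or.inl ⟨h', h⟩⟩
      · exact ⟨h.ne, Or.inr ⟨h', h.symm⟩⟩
  · intro t ht
    have ht' := Finset.mem_powerset.1 ht
    ext ⟨a, b⟩
    simp only [Finset.mem_filter, SimpleGraph.fromRel_adj]
    constructor
    · rintro ⟨h1, _, h | h⟩
      · exact h
      · have h2 := ht' h
        simp only [hs, Finset.mem_filter, Finset.mem_univ, true_and] at h1 h2
        exact (lt_asymm h1 h2).elim
    · intro h
      have h1 := ht' h
      refine ⟨h1, ?_, Or.inl h⟩
      simp only [hs, Finset.mem_filter, Finset.mem_univ, true_and] at h1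
      exact h1.ne
  · intro g _
    rw [pairProd, Finset.prod_ite]
    congr 1
    refine Finset.prod_congr ?_ fun _ _ => rfl
    ext p; simp only [Finset.mem_filter, Finset.mem_sdiff, hs]; tauto

open Classical in
/-- The weight of the graph `g` when pairs are joined with probability `p` and not joined with
probability `q`. -/
noncomputable def graphWeight {n : ℕ} (p q : Fin n → Fin n → ℝ≥0∞) (g : SimpleGraph (Fin n)) :
    ℝ≥0∞ :=
  pairProd fun a b => if g.Adj a b then p a b else q a b

open Classical in
-- The indicator is absorbed into the weight by giving weight 0 to every edge that meets `T`; the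
-- result is again a product over pairs, ready for summation over graphs.
theorem graphWeight_mul_isolated {n : ℕ} (p q : Fin n → Fin n → ℝ≥0∞) (T : Set (Fin n))
    (g : SimpleGraph (Fin n)) :
    graphWeight p q g * (if ∀ i ∈ T, ∀ j, ¬ g.Adj i j then 1 else 0) =
      pairProd fun a b => if g.Adj a b then (if a ∈ T ∨ b ∈ T then 0 else p a b) else q a b := by
  split_ifs with h
  · rw [mul_one]
    refine pairProd_congr fun a b _ => ?_
    split_ifs with h1 h2
    · rcases h2 with h2 | h2
      · exact (h a h2 b h1).elim
      · exact (h b h2 a h1.symm).elim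
    · rfl
    · rfl
  · rw [mul_zero]
    push Not at h
    obtain ⟨i, hi, j, hij⟩ := h
    symm
    rcases lt_or_gt_of_ne hij.ne with h' | h'
    · exact Finset.prod_eq_zero (i := (i, j)) (by simp [h']) (by simp [hij, hi])
    · exact Finset.prod_eq_zero (i := (j, i)) (by simp [h']) (by simp [hij.symm, hi])

open Classical in
-- Pairs that avoid `T` are unconstrained and contribute p + q = 1; the others must be non-edges.
theorem sum_graphWeight_isolated {n : ℕ} {p q : Fin n → Fin n → ℝ≥0∞}
    (hpq : ∀ a b, p a b + q a b = 1) (T : Set (Fin n)) :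
    ∑ g, graphWeight p q g * (if ∀ i ∈ T, ∀ j, ¬ g.Adj i j then 1 else 0) =
      pairProd fun a b => if a ∈ T ∨ b ∈ T then q a b else 1 := by
  simp only [graphWeight_mul_isolated]
  rw [sum_simpleGraph_pairProd]
  refine pairProd_congr fun a b _ => ?_
  split_ifs
  · simp
  · exact hpq a b

open Classical in
theorem pairProd_singleton {n : ℕ} {q : Fin (n + 1) → Fin (n + 1) → ℝ≥0∞}
    (hq : ∀ a b, q a b = q b a) (i : Fin (n + 1)) :
    (pairProd fun a b => if a ∈ ({i} : Set (Fin (n + 1))) ∨ b ∈ ({i} : Set (Fin (n + 1)))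
      then q a b else 1) = ∏ k, q i (i.succAbove k) := by
  rw [pairProd_succAbove _ _ i]
  · simp [pairProd_one, Fin.succAbove_ne]
  · intro a b; simp only [hq a b, or_comm]

open Classical in
-- The pair formed by the two chosen indices is counted once, hence the lone factor in front; each
-- remaining index meets both.
theorem pairProd_pair {n : ℕ} {q : Fin (n + 2) → Fin (n + 2) → ℝ≥0∞}
    (hq : ∀ a b, q a b = q b a) (i : Fin (n + 2)) (j : Fin (n + 1)) :
    (pairProd fun a b => if a ∈ ({i, i.succAbove j} : Set (Fin (n + 2))) ∨
        b ∈ ({i, i.succAbove j} : Set (Fin (n + 2))) then q a b else 1) =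
      q i (i.succAbove j) * ∏ k, q i (i.succAbove (j.succAbove k)) *
        q (i.succAbove j) (i.succAbove (j.succAbove k)) := by
  rw [pairProd_succAbove _ _ i]
  · have := pairProd_singleton (q := fun a b => q (i.succAbove a) (i.succAbove b))
      (fun a b => hq _ _) j
    simp only [Set.mem_singleton_iff] at this
    simp only [Set.mem_insert_iff, Set.mem_singleton_iff, Fin.succAbove_ne, false_or, true_or,
      if_true, Fin.succAbove_right_inj, this]
    rw [Fin.prod_univ_succAbove _ j, Finset.prod_mul_distrib, mul_assoc]
  · intro a b; simp only [hq a b, or_comm]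

open Classical in
theorem sum_graphWeight_adj {n : ℕ} {p q : Fin (n + 1) → Fin (n + 1) → ℝ≥0∞}
    (hp : ∀ a b, p a b = p b a) (hpq : ∀ a b, p a b + q a b = 1) (i : Fin (n + 1)) (j : Fin n) :
    ∑ g, graphWeight p q g * (if g.Adj i (i.succAbove j) then 1 else 0) =
      p i (i.succAbove j) := by
  -- Both orders are included because `pairProd_succAbove` needs a symmetric weight. Presence of the
  -- edge is imposed by giving its absence weight 0.
  set c : Fin (n + 1) → Fin (n + 1) → Prop := fun a b =>
    (a = i ∧ b = i.succAbove j) ∨ (b = i ∧ a = i.succAbove j) with hc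
  have h1 : ∀ g : SimpleGraph (Fin (n + 1)),
      graphWeight p q g * (if g.Adj i (i.succAbove j) then 1 else 0) =
      pairProd fun a b => if g.Adj a b then p a b else (if c a b then 0 else q a b) := by
    intro g
    split_ifs with h
    · rw [mul_one]
      refine pairProd_congr fun a b _ => ?_
      split_ifs with h1 h2
      · rfl
      · rcases h2 with ⟨rfl, rfl⟩ | ⟨rfl, rfl⟩
        · exact (h1 h).elim
        · exact (h1 h.symm).elim
      · rfl
    · rw [mul_zero]
      symm
      have h' : ¬ g.Adj (i.succAbove j) i := fun e => h e.symm
      rcases lt_or_gt_of_ne (Fin.succAbove_ne i j) with hlt | hlt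
      · exact Finset.prod_eq_zero (i := (i.succAbove j, i)) (by simp [hlt]) (by simp [h', hc])
      · exact Finset.prod_eq_zero (i := (i, i.succAbove j)) (by simp [hlt]) (by simp [h, hc])
  simp only [h1]
  rw [sum_simpleGraph_pairProd]
  have h2 : (pairProd fun a b => p a b + if c a b then 0 else q a b) =
      pairProd fun a b => if c a b then p a b else 1 := by
    refine pairProd_congr fun a b _ => ?_
    split_ifs
    · simp
    · exact hpq a b
  rw [h2, pairProd_succAbove _ _ i]
  · simp only [hc, Fin.succAbove_ne, (Fin.succAbove_ne _ _).symm, Fin.succAbove_right_inj, false_and,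
      and_false, or_false, true_and, if_false, pairProd_one, mul_one, Finset.prod_ite_eq',
      Finset.mem_univ, if_true]
  · intro a b
    have : c a b ↔ c b a := by simp only [hc]; tauto
    simp only [hp a b, this]

end PairProducts

/-! ### Conditional expectations given the nodes, and their integrals. -/

section SymmetricSums

variable {E : Type*}

/-- The conditional expectation of the number of isolated nodes among `x 0, …, x (n - 1)` when the
nodes `a`, `b` fail to be joined with probability `q a b`. -/
noncomputable def isolatedSum (q : E → E → ℝ≥0∞) {n : ℕ} (x : Fin n → E) : ℝ≥0∞ :=
  ∑ i, ∏ k, if k = i then 1 else q (x i) (x k)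

/-- The conditional expectation of the number of ordered pairs of distinct isolated nodes. -/
noncomputable def isolatedPairSum (q : E → E → ℝ≥0∞) {n : ℕ} (x : Fin n → E) : ℝ≥0∞ :=
  ∑ i, ∑ j, if j = i then 0 else
    q (x i) (x j) * ∏ k, if k = i ∨ k = j then 1 else q (x i) (x k) * q (x j) (x k)

/-- The conditional expectation of the sum of the degrees. -/
noncomputable def adjacentSum (p : E → E → ℝ≥0∞) {n : ℕ} (x : Fin n → E) : ℝ≥0∞ :=
  ∑ i, ∑ j, if j = i then 0 else p (x i) (x j)

theorem isolatedSum_comp (q : E → E → ℝ≥0∞) {n : ℕ} (σ : Equiv.Perm (Fin n)) (x : Fin n → E) :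
    isolatedSum q (x ∘ σ) = isolatedSum q x := by
  unfold isolatedSum
  refine Fintype.sum_equiv σ _ _ fun i => Fintype.prod_equiv σ _ _ fun k => ?_
  simp

theorem isolatedPairSum_comp (q : E → E → ℝ≥0∞) {n : ℕ} (σ : Equiv.Perm (Fin n)) (x : Fin n → E) :
    isolatedPairSum q (x ∘ σ) = isolatedPairSum q x := by
  unfold isolatedPairSum
  refine Fintype.sum_equiv σ _ _ fun i => Fintype.sum_equiv σ _ _ fun j => ?_
  have : (∏ k, if k = i ∨ k = j then 1 else q (x (σ i)) (x (σ k)) * q (x (σ j)) (x (σ k))) =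
      ∏ k, if k = σ i ∨ k = σ j then 1 else q (x (σ i)) (x k) * q (x (σ j)) (x k) :=
    Fintype.prod_equiv σ _ _ fun k => by simp
  simp [this]

theorem adjacentSum_comp (p : E → E → ℝ≥0∞) {n : ℕ} (σ : Equiv.Perm (Fin n)) (x : Fin n → E) :
    adjacentSum p (x ∘ σ) = adjacentSum p x := by
  unfold adjacentSum
  refine Fintype.sum_equiv σ _ _ fun i => Fintype.sum_equiv σ _ _ fun j => ?_
  simp

theorem isolatedSum_succ (q : E → E → ℝ≥0∞) {n : ℕ} (x : Fin (n + 1) → E) :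
    isolatedSum q x = ∑ i, ∏ k, q (x i) (x (i.succAbove k)) := by
  unfold isolatedSum
  refine Finset.sum_congr rfl fun i _ => ?_
  rw [Fin.prod_univ_succAbove _ i]
  simp [Fin.succAbove_ne]

/-- The definition, with its `if`, is convenient for permutation symmetry; this `succAbove` form is
the one that Fubini can split. -/
theorem isolatedPairSum_succ_succ (q : E → E → ℝ≥0∞) {n : ℕ} (x : Fin (n + 2) → E) :
    isolatedPairSum q x = ∑ i, ∑ j : Fin (n + 1), q (x i) (x (i.succAbove j)) *
      ∏ k, q (x i) (x (i.succAbove (j.succAbove k))) *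
        q (x (i.succAbove j)) (x (i.succAbove (j.succAbove k))) := by
  unfold isolatedPairSum
  refine Finset.sum_congr rfl fun i _ => ?_
  rw [Fin.sum_univ_succAbove _ i]
  simp only [if_true, zero_add, Fin.succAbove_ne, if_false]
  refine Finset.sum_congr rfl fun j _ => ?_
  rw [Fin.prod_univ_succAbove _ i, Fin.prod_univ_succAbove _ j]
  simp [Fin.succAbove_ne]

theorem adjacentSum_succ (p : E → E → ℝ≥0∞) {n : ℕ} (x : Fin (n + 1) → E) :
    adjacentSum p x = ∑ i, ∑ j : Fin n, p (x i) (x (i.succAbove j)) := by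
  unfold adjacentSum
  refine Finset.sum_congr rfl fun i _ => ?_
  rw [Fin.sum_univ_succAbove _ i]
  simp [Fin.succAbove_ne]

open Classical in
theorem sum_graphWeight_mul_card_isolated {p q : E → E → ℝ≥0∞} (hq : ∀ a b, q a b = q b a)
    (hpq : ∀ a b, p a b + q a b = 1) {n : ℕ} (x : Fin n → E) :
    ∑ g : SimpleGraph (Fin n), graphWeight (fun a b => p (x a) (x b)) (fun a b => q (x a) (x b)) g *
        (∑ i, if ∀ j, ¬ g.Adj i j then 1 else 0) = isolatedSum q x := by
  cases n with
  | zero => simp [isolatedSum]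
  | succ n =>
    rw [isolatedSum_succ]
    simp only [Finset.mul_sum]
    rw [Finset.sum_comm]
    refine Finset.sum_congr rfl fun i _ => ?_
    refine Eq.trans ?_ ((sum_graphWeight_isolated (p := fun a b => p (x a) (x b))
      (q := fun a b => q (x a) (x b)) (fun a b => hpq _ _) {i}).trans ?_)
    · simp
    · convert pairProd_singleton (q := fun a b => q (x a) (x b)) (fun a b => hq _ _) i

open Classical in
theorem sum_graphWeight_mul_card_isolated_pairs {p q : E → E → ℝ≥0∞} (hq : ∀ a b, q a b = q b a)
    (hpq : ∀ a b, p a b + q a b = 1) {n : ℕ} (x : Fin n → E) :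
    ∑ g : SimpleGraph (Fin n), graphWeight (fun a b => p (x a) (x b)) (fun a b => q (x a) (x b)) g *
        (∑ i, ∑ j, if j = i then 0 else
          if (∀ k, ¬ g.Adj i k) ∧ (∀ k, ¬ g.Adj j k) then 1 else 0) = isolatedPairSum q x := by
  match n with
  | 0 => simp [isolatedPairSum]
  | 1 => simp [isolatedPairSum]
  | n + 2 =>
    rw [isolatedPairSum_succ_succ]
    simp only [Finset.mul_sum]
    rw [Finset.sum_comm]
    refine Finset.sum_congr rfl fun i _ => ?_
    rw [Finset.sum_comm, Fin.sum_univ_succAbove _ i]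
    simp only [if_true, mul_zero, Finset.sum_const_zero, zero_add, Fin.succAbove_ne, if_false]
    refine Finset.sum_congr rfl fun j _ => ?_
    refine Eq.trans ?_ ((sum_graphWeight_isolated (p := fun a b => p (x a) (x b))
      (q := fun a b => q (x a) (x b)) (fun a b => hpq _ _) {i, i.succAbove j}).trans ?_)
    · simp
    · convert pairProd_pair (q := fun a b => q (x a) (x b)) (fun a b => hq _ _) i j

open Classical in
theorem sum_graphWeight_mul_degrees {p q : E → E → ℝ≥0∞} (hp : ∀ a b, p a b = p b a)
    (hpq : ∀ a b, p a b + q a b = 1) {n : ℕ} (x : Fin n → E) :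
    ∑ g : SimpleGraph (Fin n), graphWeight (fun a b => p (x a) (x b)) (fun a b => q (x a) (x b)) g *
        (∑ i, ∑ j, if g.Adj i j then 1 else 0) = adjacentSum p x := by
  cases n with
  | zero => simp [adjacentSum]
  | succ n =>
    rw [adjacentSum_succ]
    simp only [Finset.mul_sum]
    rw [Finset.sum_comm]
    refine Finset.sum_congr rfl fun i _ => ?_
    rw [Finset.sum_comm, Fin.sum_univ_succAbove _ i]
    simp only [SimpleGraph.irrefl, if_false, mul_zero, Finset.sum_const_zero, zero_add]
    refine Finset.sum_congr rfl fun j _ => ?_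
    exact sum_graphWeight_adj (p := fun a b => p (x a) (x b)) (fun a b => hp _ _)
      (fun a b => hpq _ _) i j

variable [MeasurableSpace E]

theorem measurable_apply_pair {q : E → E → ℝ≥0∞} (hq : Measurable (Function.uncurry q)) {n : ℕ}
    (i k : Fin n) : Measurable fun x : Fin n → E => q (x i) (x k) :=
  show Measurable (Function.uncurry q ∘ fun x : Fin n → E => (x i, x k)) from
    hq.comp ((measurable_pi_apply i).prodMk (measurable_pi_apply k))

theorem measurable_isolatedSum {q : E → E → ℝ≥0∞} (hq : Measurable (Function.uncurry q)) (n : ℕ) :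
    Measurable (isolatedSum q : (Fin n → E) → ℝ≥0∞) := by
  have hq' := fun i k => measurable_apply_pair hq (n := n) i k
  unfold isolatedSum
  refine Finset.measurable_fun_sum _ fun i _ => Finset.measurable_fun_prod _ fun k _ => ?_
  split_ifs
  · exact measurable_const
  · exact hq' i k

theorem measurable_isolatedPairSum {q : E → E → ℝ≥0∞} (hq : Measurable (Function.uncurry q))
    (n : ℕ) : Measurable (isolatedPairSum q : (Fin n → E) → ℝ≥0∞) := by
  have hq' := fun i k => measurable_apply_pair hq (n := n) i k
  unfold isolatedPairSum
  refine Finset.measurable_fun_sum _ fun i _ => Finset.measurable_fun_sum _ fun j _ => ?_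
  split_ifs
  · exact measurable_const
  · refine (hq' i j).mul (Finset.measurable_fun_prod _ fun k _ => ?_)
    split_ifs
    · exact measurable_const
    · exact (hq' i k).mul (hq' j k)

theorem measurable_adjacentSum {p : E → E → ℝ≥0∞} (hp : Measurable (Function.uncurry p)) (n : ℕ) :
    Measurable (adjacentSum p : (Fin n → E) → ℝ≥0∞) := by
  unfold adjacentSum
  refine Finset.measurable_fun_sum _ fun i _ => Finset.measurable_fun_sum _ fun j _ => ?_
  split_ifs
  · exact measurable_const
  · exact measurable_apply_pair hp i j

variable {ν : Measure E} [IsFiniteMeasure ν]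

theorem lintegral_pi_insertNth {n : ℕ} (i : Fin (n + 1)) {f : (Fin (n + 1) → E) → ℝ≥0∞}
    (hf : Measurable f) :
    ∫⁻ x, f x ∂Measure.pi (fun _ => ν) =
      ∫⁻ a, ∫⁻ y, f (i.insertNth a y) ∂Measure.pi (fun _ => ν) ∂ν := by
  have h := (measurePreserving_piFinSuccAbove (fun _ : Fin (n + 1) => ν) i).symm
  rw [← h.lintegral_comp_emb (MeasurableEquiv.measurableEmbedding _), lintegral_prod]
  · rfl
  · exact (hf.comp (MeasurableEquiv.measurable _)).aemeasurable

theorem lintegral_pi_prod {u : E → ℝ≥0∞} (hu : Measurable u) (n : ℕ) :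
    ∫⁻ x, ∏ k, u (x k) ∂Measure.pi (fun _ : Fin n => ν) = (∫⁻ a, u a ∂ν) ^ n := by
  induction n with
  | zero => simp
  | succ n ih =>
    have hm : ∀ n : ℕ, Measurable fun x : Fin n → E => ∏ k, u (x k) := fun n =>
      Finset.measurable_fun_prod _ fun k _ => hu.comp (measurable_pi_apply k)
    rw [lintegral_pi_insertNth 0 (hm _)]
    have : ∀ a, ∫⁻ y, ∏ k, u ((Fin.insertNth 0 a y : Fin (n + 1) → E) k)
        ∂Measure.pi (fun _ : Fin n => ν) = u a * (∫⁻ a, u a ∂ν) ^ n := by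
      intro a
      rw [← ih, ← lintegral_const_mul _ (hm _)]
      simp [Fin.prod_univ_succ]
    simp only [this]
    rw [lintegral_mul_const _ hu, pow_succ']

/-- With the distinguished coordinate fixed at a, the other n coordinates separate and give a power;
each of the n + 1 choices contributes the same. -/
theorem lintegral_isolatedSum {q : E → E → ℝ≥0∞} (hq : Measurable (Function.uncurry q)) (n : ℕ) :
    ∫⁻ x, isolatedSum q x ∂Measure.pi (fun _ : Fin (n + 1) => ν) =
      (n + 1 : ℕ) * ∫⁻ a, (∫⁻ y, q a y ∂ν) ^ n ∂ν := by
  have hq' := fun i k => measurable_apply_pair hq (n := n + 1) i k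
  have hm : ∀ i : Fin (n + 1), Measurable fun x : Fin (n + 1) → E =>
      ∏ k, q (x i) (x (i.succAbove k)) := fun i =>
    Finset.measurable_fun_prod _ fun k _ => hq' _ _
  simp only [isolatedSum_succ]
  rw [lintegral_finsetSum _ fun i _ => hm i]
  have : ∀ i : Fin (n + 1), ∫⁻ x : Fin (n + 1) → E, ∏ k, q (x i) (x (i.succAbove k))
      ∂Measure.pi (fun _ => ν) = ∫⁻ a, (∫⁻ y, q a y ∂ν) ^ n ∂ν := fun i => by
    rw [lintegral_pi_insertNth i (hm i)]
    refine lintegral_congr fun a => ?_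
    simp only [Fin.insertNth_apply_same, Fin.insertNth_apply_succAbove]
    exact lintegral_pi_prod (u := fun y => q a y) (hq.comp measurable_prodMk_left) n
  simp [this]

theorem lintegral_isolatedPairSum {q : E → E → ℝ≥0∞} (hq : Measurable (Function.uncurry q))
    (n : ℕ) :
    ∫⁻ x, isolatedPairSum q x ∂Measure.pi (fun _ : Fin (n + 2) => ν) =
      ((n + 2) * (n + 1) : ℕ) * ∫⁻ a, ∫⁻ b, q a b * (∫⁻ z, q a z * q b z ∂ν) ^ n ∂ν ∂ν := by
  have hq' := fun i k => measurable_apply_pair hq (n := n + 2) i k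
  have hm : ∀ (i : Fin (n + 2)) (j : Fin (n + 1)), Measurable fun x : Fin (n + 2) → E =>
      q (x i) (x (i.succAbove j)) * ∏ k, q (x i) (x (i.succAbove (j.succAbove k))) *
        q (x (i.succAbove j)) (x (i.succAbove (j.succAbove k))) := fun i j =>
    (hq' _ _).mul (Finset.measurable_fun_prod _ fun k _ => (hq' _ _).mul (hq' _ _))
  simp only [isolatedPairSum_succ_succ]
  rw [lintegral_finsetSum _ fun i _ => Finset.measurable_fun_sum _ fun j _ => hm i j]
  have : ∀ i : Fin (n + 2), ∫⁻ x : Fin (n + 2) → E, ∑ j : Fin (n + 1),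
      q (x i) (x (i.succAbove j)) * ∏ k, q (x i) (x (i.succAbove (j.succAbove k))) *
        q (x (i.succAbove j)) (x (i.succAbove (j.succAbove k)))
      ∂Measure.pi (fun _ => ν) =
      (n + 1 : ℕ) * ∫⁻ a, ∫⁻ b, q a b * (∫⁻ z, q a z * q b z ∂ν) ^ n ∂ν ∂ν := fun i => by
    rw [lintegral_finsetSum _ fun j _ => hm i j]
    have : ∀ j : Fin (n + 1), ∫⁻ x : Fin (n + 2) → E,
        q (x i) (x (i.succAbove j)) * ∏ k, q (x i) (x (i.succAbove (j.succAbove k))) *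
          q (x (i.succAbove j)) (x (i.succAbove (j.succAbove k)))
        ∂Measure.pi (fun _ => ν) =
        ∫⁻ a, ∫⁻ b, q a b * (∫⁻ z, q a z * q b z ∂ν) ^ n ∂ν ∂ν := fun j => by
      rw [lintegral_pi_insertNth i (hm i j)]
      refine lintegral_congr fun a => ?_
      simp only [Fin.insertNth_apply_same, Fin.insertNth_apply_succAbove]
      have hqa : Measurable fun y => q a y := hq.comp measurable_prodMk_left
      rw [lintegral_pi_insertNth j]
      · refine lintegral_congr fun b => ?_
        simp only [Fin.insertNth_apply_same, Fin.insertNth_apply_succAbove]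
        have hqb : Measurable fun y => q b y := hq.comp measurable_prodMk_left
        rw [lintegral_const_mul, lintegral_pi_prod (u := fun y => q a y * q b y) (hqa.mul hqb) n]
        exact Finset.measurable_fun_prod _ fun k _ =>
          (hqa.mul hqb).comp (measurable_pi_apply _)
      · refine (hqa.comp (measurable_pi_apply _)).mul (Finset.measurable_fun_prod _ fun k _ => ?_)
        exact (hqa.comp (measurable_pi_apply _)).mul (measurable_apply_pair hq _ _)
    simp [this]
  simp only [this]
  simp [mul_assoc]

theorem lintegral_adjacentSum {p : E → E → ℝ≥0∞} (hp : Measurable (Function.uncurry p)) (n : ℕ) :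
    ∫⁻ x, adjacentSum p x ∂Measure.pi (fun _ : Fin (n + 2) => ν) =
      ((n + 2) * (n + 1) : ℕ) * (∫⁻ a, ∫⁻ b, p a b ∂ν ∂ν) * ν Set.univ ^ n := by
  have hp' := fun i k => measurable_apply_pair hp (n := n + 2) i k
  simp only [adjacentSum_succ]
  rw [lintegral_finsetSum _ fun i _ => Finset.measurable_fun_sum _ fun j _ => hp' _ _]
  have : ∀ i : Fin (n + 2), ∫⁻ x : Fin (n + 2) → E, ∑ j : Fin (n + 1), p (x i) (x (i.succAbove j))
      ∂Measure.pi (fun _ => ν) =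
      (n + 1 : ℕ) * ((∫⁻ a, ∫⁻ b, p a b ∂ν ∂ν) * ν Set.univ ^ n) := fun i => by
    rw [lintegral_finsetSum _ fun j _ => hp' _ _]
    have : ∀ j : Fin (n + 1), ∫⁻ x : Fin (n + 2) → E, p (x i) (x (i.succAbove j))
        ∂Measure.pi (fun _ => ν) = (∫⁻ a, ∫⁻ b, p a b ∂ν ∂ν) * ν Set.univ ^ n := fun j => by
      rw [lintegral_pi_insertNth i (hp' _ _), ← lintegral_mul_const]
      · refine lintegral_congr fun a => ?_
        simp only [Fin.insertNth_apply_same, Fin.insertNth_apply_succAbove]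
        have hpa : Measurable fun y => p a y := hp.comp measurable_prodMk_left
        have hm : Measurable fun y : Fin (n + 1) → E => p a (y j) :=
          hpa.comp (measurable_pi_apply j)
        rw [lintegral_pi_insertNth j hm, ← lintegral_mul_const _ hpa]
        simp [Measure.pi_univ]
      · exact hp.lintegral_prod_right'
    simp [this]
  simp only [this]
  simp [mul_assoc, add_assoc, one_add_one_eq_two]

end SymmetricSums

/-! ### Summation over the number of points. -/

section Series

/-- In use r is the total mass and t the mass surviving a thinning by non-joining probabilities, so
t - r is minus the mean number of points removed. -/
theorem tsum_div_factorial_mul_pow (r : ℝ) {t : ℝ≥0∞} (ht : t ≠ ⊤) :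
    ∑' n : ℕ, ENNReal.ofReal (Real.exp (-r)) / n.factorial * t ^ n =
      ENNReal.ofReal (Real.exp (t.toReal - r)) := by
  have h1 : ∀ n : ℕ, ENNReal.ofReal (Real.exp (-r)) / n.factorial * t ^ n =
      ENNReal.ofReal (Real.exp (-r)) * ENNReal.ofReal (t.toReal ^ n / n.factorial) := fun n => by
    rw [ENNReal.ofReal_div_of_pos (by positivity), ENNReal.ofReal_pow ENNReal.toReal_nonneg,
      ENNReal.ofReal_toReal ht, ENNReal.ofReal_natCast]
    simp only [div_eq_mul_inv]; ring
  simp only [h1]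
  rw [ENNReal.tsum_mul_left, ← ENNReal.ofReal_tsum_of_nonneg (fun n => by positivity)
    (Real.summable_pow_div_factorial _), ← ENNReal.ofReal_mul (by positivity), sub_eq_neg_add,
    Real.exp_add]
  congr 2
  rw [Real.exp_eq_exp_ℝ, NormedSpace.exp_eq_tsum_div]

theorem ENNReal.div_factorial_succ_mul (c : ℝ≥0∞) (n : ℕ) :
    c / ((n + 1).factorial : ℕ) * (n + 1 : ℕ) = c / (n.factorial : ℕ) := by
  have h0 : ((n + 1 : ℕ) : ℝ≥0∞) ≠ 0 := by exact_mod_cast n.succ_ne_zero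
  rw [Nat.factorial_succ, Nat.cast_mul, div_eq_mul_inv,
    ENNReal.mul_inv (Or.inl h0) (Or.inl (ENNReal.natCast_ne_top _)), div_eq_mul_inv,
    mul_comm ((n + 1 : ℕ) : ℝ≥0∞)⁻¹, mul_assoc, mul_assoc,
    ENNReal.inv_mul_cancel h0 (ENNReal.natCast_ne_top _), mul_one]

variable {E : Type*} [MeasurableSpace E] {ν : Measure E} [IsFiniteMeasure ν]

theorem lintegral_ne_top_of_le_one {u : E → ℝ≥0∞} (hu : ∀ a, u a ≤ 1) : ∫⁻ a, u a ∂ν ≠ ⊤ :=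
  ((lintegral_mono hu).trans_lt (by simp)).ne

/-- Choosing the distinguished point turns 1/(n + 1)! into 1/n!, so the remaining points again form
a full Poisson series: a Mecke formula by hand. -/
theorem tsum_lintegral_isolatedSum {q : E → E → ℝ≥0∞} (hq : Measurable (Function.uncurry q))
    (hq1 : ∀ a b, q a b ≤ 1) (r : ℝ) :
    ∑' n : ℕ, ENNReal.ofReal (Real.exp (-r)) / n.factorial *
        ∫⁻ x, isolatedSum q x ∂Measure.pi (fun _ : Fin n => ν) =
      ∫⁻ a, ENNReal.ofReal (Real.exp ((∫⁻ y, q a y ∂ν).toReal - r)) ∂ν := by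
  rw [tsum_eq_zero_add' ENNReal.summable]
  have h0 : ∀ x : Fin 0 → E, isolatedSum q x = 0 := fun x => by simp [isolatedSum]
  simp only [h0, lintegral_zero, mul_zero, zero_add, lintegral_isolatedSum hq, ← mul_assoc,
    ENNReal.div_factorial_succ_mul]
  have hm : Measurable fun a => ∫⁻ y, q a y ∂ν := hq.lintegral_prod_right'
  simp only [← lintegral_const_mul _ (hm.pow_const _)]
  rw [← lintegral_tsum fun n => ((hm.pow_const n).const_mul _).aemeasurable]
  exact lintegral_congr fun a =>
    tsum_div_factorial_mul_pow r (lintegral_ne_top_of_le_one fun b => hq1 a b)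

theorem tsum_lintegral_isolatedPairSum {q : E → E → ℝ≥0∞} (hq : Measurable (Function.uncurry q))
    (hq1 : ∀ a b, q a b ≤ 1) (r : ℝ) :
    ∑' n : ℕ, ENNReal.ofReal (Real.exp (-r)) / n.factorial *
        ∫⁻ x, isolatedPairSum q x ∂Measure.pi (fun _ : Fin n => ν) =
      ∫⁻ a, ∫⁻ b, q a b * ENNReal.ofReal (Real.exp ((∫⁻ z, q a z * q b z ∂ν).toReal - r)) ∂ν ∂ν := by
  -- Fewer than two points carry no pair, so the series effectively starts at n = 2.
  rw [tsum_eq_zero_add' ENNReal.summable, tsum_eq_zero_add' ENNReal.summable]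
  have h0 : ∀ x : Fin 0 → E, isolatedPairSum q x = 0 := fun x => by simp [isolatedPairSum]
  have h1 : ∀ x : Fin (0 + 1) → E, isolatedPairSum q x = 0 := fun x => by simp [isolatedPairSum]
  simp only [h0, h1, lintegral_zero, mul_zero, zero_add, add_assoc, Nat.reduceAdd,
    lintegral_isolatedPairSum hq]
  have hc : ∀ n : ℕ, ENNReal.ofReal (Real.exp (-r)) / ((n + 2).factorial : ℕ) *
      ((n + 2) * (n + 1) : ℕ) = ENNReal.ofReal (Real.exp (-r)) / (n.factorial : ℕ) := fun n => by
    rw [Nat.cast_mul, ← mul_assoc, ENNReal.div_factorial_succ_mul, ENNReal.div_factorial_succ_mul]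
  simp only [← mul_assoc, hc]
  have hm : Measurable fun ab : E × E => ∫⁻ z, q ab.1 z * q ab.2 z ∂ν := by
    refine Measurable.lintegral_prod_right' (f := fun w : (E × E) × E => q w.1.1 w.2 * q w.1.2 w.2) ?_
    exact (hq.comp (measurable_fst.fst.prodMk measurable_snd)).mul
      (hq.comp (measurable_fst.snd.prodMk measurable_snd))
  have hm2 : ∀ n : ℕ, Measurable fun ab : E × E =>
      q ab.1 ab.2 * (∫⁻ z, q ab.1 z * q ab.2 z ∂ν) ^ n := fun n => hq.mul (hm.pow_const n)
  have e : ∀ n : ℕ, ENNReal.ofReal (Real.exp (-r)) / (n.factorial : ℕ) *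
      ∫⁻ a, ∫⁻ b, q a b * (∫⁻ z, q a z * q b z ∂ν) ^ n ∂ν ∂ν =
      ∫⁻ a, ∫⁻ b, ENNReal.ofReal (Real.exp (-r)) / (n.factorial : ℕ) *
        (q a b * (∫⁻ z, q a z * q b z ∂ν) ^ n) ∂ν ∂ν := fun n => by
    rw [← lintegral_const_mul _ (hm2 n).lintegral_prod_right']
    refine lintegral_congr fun a => ?_
    rw [← lintegral_const_mul]
    exact (hm2 n).comp measurable_prodMk_left
  simp only [e]
  rw [← lintegral_tsum fun n => ((hm2 n).const_mul _).lintegral_prod_right'.aemeasurable]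
  refine lintegral_congr fun a => ?_
  have hm3 : ∀ n : ℕ, Measurable fun b => ENNReal.ofReal (Real.exp (-r)) / (n.factorial : ℕ) *
      (q a b * (∫⁻ z, q a z * q b z ∂ν) ^ n) := fun n =>
    ((hm2 n).const_mul _).comp measurable_prodMk_left
  dsimp only
  rw [← lintegral_tsum fun n => (hm3 n).aemeasurable]
  refine lintegral_congr fun b => ?_
  simp only [mul_left_comm _ (q a b)]
  rw [ENNReal.tsum_mul_left, tsum_div_factorial_mul_pow]
  exact lintegral_ne_top_of_le_one fun z => mul_le_one' (hq1 a z) (hq1 b z)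

theorem tsum_lintegral_adjacentSum {p : E → E → ℝ≥0∞} (hp : Measurable (Function.uncurry p)) :
    ∑' n : ℕ, ENNReal.ofReal (Real.exp (-ν.real Set.univ)) / n.factorial *
        ∫⁻ x, adjacentSum p x ∂Measure.pi (fun _ : Fin n => ν) =
      ∫⁻ a, ∫⁻ b, p a b ∂ν ∂ν := by
  rw [tsum_eq_zero_add' ENNReal.summable, tsum_eq_zero_add' ENNReal.summable]
  have h0 : ∀ x : Fin 0 → E, adjacentSum p x = 0 := fun x => by simp [adjacentSum]
  have h1 : ∀ x : Fin (0 + 1) → E, adjacentSum p x = 0 := fun x => by simp [adjacentSum]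
  simp only [h0, h1, lintegral_zero, mul_zero, zero_add, add_assoc, Nat.reduceAdd,
    lintegral_adjacentSum hp]
  have hc : ∀ n : ℕ, ENNReal.ofReal (Real.exp (-ν.real Set.univ)) / ((n + 2).factorial : ℕ) *
      (((n + 2) * (n + 1) : ℕ) * (∫⁻ a, ∫⁻ b, p a b ∂ν ∂ν) * ν Set.univ ^ n) =
      (∫⁻ a, ∫⁻ b, p a b ∂ν ∂ν) *
        (ENNReal.ofReal (Real.exp (-ν.real Set.univ)) / (n.factorial : ℕ) * ν Set.univ ^ n) := by
    intro n
    rw [← mul_assoc, ← mul_assoc, Nat.cast_mul, ← mul_assoc, ENNReal.div_factorial_succ_mul,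
      ENNReal.div_factorial_succ_mul, mul_comm (_ / _), mul_assoc]
  simp only [hc]
  rw [ENNReal.tsum_mul_left, tsum_div_factorial_mul_pow _ (measure_ne_top _ _)]
  simp [Measure.real]

end Series

/-! ### Moments of the random graph. -/

section RandomGraph

variable {Ω E : Type*}

/-- The event that there are `n` nodes, and that the graph on the enumerated nodes is `g`. -/
def graphEvent (V : Ω → Finset E) (G : Ω → SimpleGraph E) (X : ℕ → Ω → E)
    (s : Σ n, SimpleGraph (Fin n)) : Set Ω :=
  {ω | (V ω).card = s.1 ∧ ∀ i j : Fin s.1, (G ω).Adj (X i ω) (X j ω) ↔ s.2.Adj i j}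

variable {V : Ω → Finset E} {G : Ω → SimpleGraph E} {X : ℕ → Ω → E}

theorem pairwise_disjoint_graphEvent : Pairwise (Function.onFun Disjoint (graphEvent V G X)) := by
  rintro ⟨n, g⟩ ⟨m, g'⟩ hne
  rw [Function.onFun, Set.disjoint_left]
  rintro ω ⟨h1, h2⟩ ⟨h3, h4⟩
  dsimp only at h1 h2 h3 h4
  obtain rfl : n = m := h1.symm.trans h3
  refine hne ?_
  congr 1
  ext i j
  rw [← h2, ← h4]

theorem iUnion_graphEvent : ⋃ s, graphEvent V G X s = Set.univ := by
  refine Set.eq_univ_of_forall fun ω => Set.mem_iUnion.2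
    ⟨⟨(V ω).card, (G ω).comap fun i => X i ω⟩, rfl, fun i j => ?_⟩
  simp

theorem bijOn_enum_fin (hX : ∀ ω, Set.BijOn (fun i => X i ω) (Set.Iio (V ω).card) (V ω)) {n : ℕ}
    {ω : Ω} (hn : (V ω).card = n) :
    ∃ f : Fin n ↪ E, (∀ i, f i = X i ω) ∧ V ω = Finset.univ.map f := by
  have hinj : Function.Injective fun i : Fin n => X i ω := fun i j hij => Fin.ext <|
    (hX ω).injOn (by simp [hn]) (by simp [hn]) hij
  refine ⟨⟨_, hinj⟩, fun i => rfl, ?_⟩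
  symm
  refine Finset.eq_of_subset_of_card_le (fun y hy => ?_) (by simp [hn])
  obtain ⟨i, -, rfl⟩ := Finset.mem_map.1 hy
  exact (hX ω).mapsTo (show (i : ℕ) ∈ Set.Iio (V ω).card by simp [hn])

open Classical in
theorem numIsolated_eq_of_mem_graphEvent
    (hX : ∀ ω, Set.BijOn (fun i => X i ω) (Set.Iio (V ω).card) (V ω)) {n : ℕ}
    {g : SimpleGraph (Fin n)} {ω : Ω} (hω : ω ∈ graphEvent V G X ⟨n, g⟩) :
    numIsolated (V ω) (G ω) = ∑ i, if ∀ j, ¬ g.Adj i j then 1 else 0 := by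
  obtain ⟨hn, hg⟩ := hω
  obtain ⟨f, hf, hV⟩ := bijOn_enum_fin hX hn
  have : {x : E | x ∈ V ω ∧ ∀ y ∈ V ω, y ≠ x → ¬ (G ω).Adj x y} =
      f '' {i | ∀ j, ¬ g.Adj i j} := by
    ext x
    simp only [hV, Finset.mem_map, Finset.mem_univ, true_and, Set.mem_ofPred_eq, Set.mem_image]
    constructor
    · rintro ⟨⟨i, rfl⟩, h⟩
      refine ⟨i, fun j hij => ?_, rfl⟩
      refine h _ ⟨j, rfl⟩ (f.injective.ne hij.ne.symm) ?_
      rw [hf, hf]; exact (hg i j).2 hij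
    · rintro ⟨i, hi, rfl⟩
      refine ⟨⟨i, rfl⟩, ?_⟩
      rintro _ ⟨j, rfl⟩ _ h
      rw [hf, hf] at h
      exact hi j ((hg i j).1 h)
  rw [numIsolated, this, Set.ncard_image_of_injective _ f.injective, Set.ncard_eq_toFinset_card',
    Finset.sum_boole, Nat.cast_id]
  congr 1
  ext i; simp

open Classical in
theorem sum_degree_eq_of_mem_graphEvent
    (hX : ∀ ω, Set.BijOn (fun i => X i ω) (Set.Iio (V ω).card) (V ω)) {n : ℕ}
    {g : SimpleGraph (Fin n)} {ω : Ω} (hω : ω ∈ graphEvent V G X ⟨n, g⟩) :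
    ∑ x ∈ V ω, {y : E | y ∈ V ω ∧ (G ω).Adj x y}.ncard =
      ∑ i, ∑ j, if g.Adj i j then 1 else 0 := by
  obtain ⟨hn, hg⟩ := hω
  obtain ⟨f, hf, hV⟩ := bijOn_enum_fin hX hn
  rw [hV, Finset.sum_map]
  refine Finset.sum_congr rfl fun i _ => ?_
  have : {y : E | y ∈ Finset.univ.map f ∧ (G ω).Adj (f i) y} = f '' {j | g.Adj i j} := by
    ext x
    simp only [Finset.mem_map, Finset.mem_univ, true_and, Set.mem_ofPred_eq, Set.mem_image]
    constructor
    · rintro ⟨⟨j, rfl⟩, h⟩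
      refine ⟨j, ?_, rfl⟩
      rw [hf, hf] at h
      exact (hg i j).1 h
    · rintro ⟨j, hj, rfl⟩
      refine ⟨⟨j, rfl⟩, ?_⟩
      rw [hf, hf]; exact (hg i j).2 hj
  rw [this, Set.ncard_image_of_injective _ f.injective, Set.ncard_eq_toFinset_card',
    Finset.sum_boole, Nat.cast_id]
  congr 1
  ext i; simp

theorem ofReal_graphProb {h : E → E → ℝ} (h0 : ∀ x y, 0 ≤ h x y) (h1 : ∀ x y, h x y ≤ 1) {n : ℕ}
    (x : Fin n → E) (g : SimpleGraph (Fin n)) :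
    ENNReal.ofReal (graphProb h x g) =
      graphWeight (fun a b => ENNReal.ofReal (h (x a) (x b)))
        (fun a b => ENNReal.ofReal (1 - h (x a) (x b))) g := by
  rw [graphProb, graphWeight, pairProd, ENNReal.ofReal_prod_of_nonneg]
  · refine Finset.prod_congr rfl fun p _ => ?_
    split_ifs <;> rfl
  · intro p _
    split_ifs
    · exact h0 _ _
    · linarith [h1 (x p.1) (x p.2)]

variable [MeasurableSpace Ω] [MeasurableSpace E] {P : Measure Ω} {h : E → E → ℝ}

theorem HasIndependentEdges.measurableSet_graphEvent (hE : HasIndependentEdges P h V G X)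
    (s : Σ n, SimpleGraph (Fin n)) : MeasurableSet (graphEvent V G X s) :=
  hE.measurableSet_graph s.1 s.2

/-- The graph events form a countable measurable partition on whose pieces `F` is constant, so no
measurability of `G` or of `Φ` is needed. -/
theorem HasIndependentEdges.measurable_of_graphEvent (hE : HasIndependentEdges P h V G X)
    {β : Type*} [MeasurableSpace β] {F : Ω → β} {Φ : (Σ n, SimpleGraph (Fin n)) → β}
    (hF : ∀ s, ∀ ω ∈ graphEvent V G X s, F ω = Φ s) : Measurable F := by
  intro S _
  have : F ⁻¹' S = ⋃ s : {s // Φ s ∈ S}, graphEvent V G X s := by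
    ext ω
    obtain ⟨s, hs⟩ := Set.mem_iUnion.1 (iUnion_graphEvent (V := V) (G := G) (X := X) ▸
      Set.mem_univ ω : ω ∈ ⋃ s, graphEvent V G X s)
    constructor
    · intro hω
      exact Set.mem_iUnion.2 ⟨⟨s, by rw [← hF s ω hs]; exact hω⟩, hs⟩
    · intro hω
      obtain ⟨⟨t, ht⟩, hωt⟩ := Set.mem_iUnion.1 hω
      rw [Set.mem_preimage, hF t ω hωt]; exact ht
  rw [this]
  exact MeasurableSet.iUnion fun s => hE.measurableSet_graphEvent _

theorem HasIndependentEdges.measure_graphEvent (hE : HasIndependentEdges P h V G X)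
    (h0 : ∀ x y, 0 ≤ h x y) (h1 : ∀ x y, h x y ≤ 1) (n : ℕ) (g : SimpleGraph (Fin n)) :
    P (graphEvent V G X ⟨n, g⟩) = ∫⁻ ω in {ω | (V ω).card = n},
      graphWeight (fun a b => ENNReal.ofReal (h (X a ω) (X b ω)))
        (fun a b => ENNReal.ofReal (1 - h (X a ω) (X b ω))) g ∂P := by
  have := hE.law_graph n g Set.univ MeasurableSet.univ
  simp only [Set.mem_univ, and_true, ofReal_graphProb h0 h1] at this
  rw [← this]
  congr 1
  ext ω; simp [graphEvent]

theorem measurable_graphWeight {p q : E → E → ℝ≥0∞} (hp : Measurable (Function.uncurry p))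
    (hq : Measurable (Function.uncurry q)) {n : ℕ} (g : SimpleGraph (Fin n)) :
    Measurable fun x : Fin n → E =>
      graphWeight (fun a b => p (x a) (x b)) (fun a b => q (x a) (x b)) g := by
  unfold graphWeight pairProd
  refine Finset.measurable_fun_prod _ fun c _ => ?_
  dsimp only
  split_ifs
  · exact measurable_apply_pair hp _ _
  · exact measurable_apply_pair hq _ _

theorem HasIndependentEdges.measurable_numIsolated (hE : HasIndependentEdges P h V G X) :
    Measurable fun ω => numIsolated (V ω) (G ω) := by
  classical
  exact hE.measurable_of_graphEvent
    (Φ := fun s => ∑ i, if ∀ j, ¬ s.2.Adj i j then 1 else 0)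
    fun s ω hω => numIsolated_eq_of_mem_graphEvent hE.bijOn_enum hω

variable {ν : Measure E} [IsFiniteMeasure ν]

theorem IsPoissonProcess.lintegral_card (hV : IsPoissonProcess P ν V) :
    ∫⁻ ω, ((V ω).card : ℝ≥0∞) ∂P = ν Set.univ := by
  have hc : Measurable fun ω => (V ω).card := by
    simpa [pointCount_univ] using hV.measurable_count Set.univ MeasurableSet.univ
  rw [← lintegral_map (f := fun n : ℕ => (n : ℝ≥0∞)) (measurable_of_countable _) hc,
    lintegral_countable']
  have e : ∀ n : ℕ, P.map (fun ω => (V ω).card) {n} =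
      ENNReal.ofReal (Real.exp (-ν.real Set.univ)) / n.factorial * ν Set.univ ^ n := fun n => by
    rw [Measure.map_apply hc (measurableSet_singleton n)]
    refine (hV.measure_card_eq n).trans ?_
    rw [ENNReal.ofReal_div_of_pos (by positivity), ENNReal.ofReal_mul (by positivity),
      ENNReal.ofReal_pow measureReal_nonneg, ENNReal.ofReal_natCast,
      measureReal_def ν, ENNReal.ofReal_toReal (measure_ne_top _ _)]
    simp only [div_eq_mul_inv]; ring
  simp only [e]
  rw [tsum_eq_zero_add' ENNReal.summable]
  have e2 : ∀ n : ℕ, ((n + 1 : ℕ) : ℝ≥0∞) *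
      (ENNReal.ofReal (Real.exp (-ν.real Set.univ)) / ((n + 1).factorial : ℕ) *
        ν Set.univ ^ (n + 1)) = ν Set.univ *
      (ENNReal.ofReal (Real.exp (-ν.real Set.univ)) / (n.factorial : ℕ) * ν Set.univ ^ n) := by
    intro n
    rw [← ENNReal.div_factorial_succ_mul _ n, pow_succ]; ring
  simp only [e2]
  rw [ENNReal.tsum_mul_left, tsum_div_factorial_mul_pow _ (measure_ne_top _ _)]
  simp [Measure.real]

variable [TopologicalSpace E] [T2Space E] [SecondCountableTopology E] [BorelSpace E]

/-- The expectation of a function of the graph whose conditional expectation, given the nodes, is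
a symmetric function of the nodes. -/
theorem HasIndependentEdges.lintegral_eq_tsum (hV : IsPoissonProcess P ν V)
    (hE : HasIndependentEdges P h V G X) (hm : Measurable (Function.uncurry h))
    (h0 : ∀ x y, 0 ≤ h x y) (h1 : ∀ x y, h x y ≤ 1)
    {F : Ω → ℝ≥0∞} {Φ : ∀ n, SimpleGraph (Fin n) → ℝ≥0∞}
    (hF : ∀ n g, ∀ ω ∈ graphEvent V G X ⟨n, g⟩, F ω = Φ n g)
    {K : ∀ n, (Fin n → E) → ℝ≥0∞} (hKm : ∀ n, Measurable (K n))
    (hsymm : ∀ n (σ : Equiv.Perm (Fin n)) x, K n (x ∘ σ) = K n x)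
    (hK : ∀ n x, ∑ g, graphWeight (fun a b => ENNReal.ofReal (h (x a) (x b)))
        (fun a b => ENNReal.ofReal (1 - h (x a) (x b))) g * Φ n g = K n x) :
    ∫⁻ ω, F ω ∂P = ∑' n : ℕ, ENNReal.ofReal (Real.exp (-ν.real Set.univ)) / n.factorial *
      ∫⁻ x, K n x ∂Measure.pi fun _ => ν := by
  rw [← setLIntegral_univ, ← iUnion_graphEvent (V := V) (G := G) (X := X),
    lintegral_iUnion hE.measurableSet_graphEvent pairwise_disjoint_graphEvent,
    ENNReal.tsum_sigma']
  refine tsum_congr fun n => ?_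
  rw [← hV.lintegral_enum hE.measurable_enum hE.bijOn_enum (hKm n) (hsymm n), tsum_fintype]
  have hp' : Measurable (Function.uncurry fun x y => ENNReal.ofReal (h x y)) := hm.ennreal_ofReal
  have hq' : Measurable (Function.uncurry fun x y => ENNReal.ofReal (1 - h x y)) :=
    (measurable_const.sub hm).ennreal_ofReal
  have hXm : Measurable fun ω => fun i : Fin n => X i ω :=
    measurable_pi_lambda _ fun i => hE.measurable_enum _
  have hw : ∀ g : SimpleGraph (Fin n), Measurable fun ω =>
      graphWeight (fun a b : Fin n => ENNReal.ofReal (h (X a ω) (X b ω)))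
        (fun a b => ENNReal.ofReal (1 - h (X a ω) (X b ω))) g := fun g =>
    (measurable_graphWeight hp' hq' g).comp hXm
  simp only [← hK]
  rw [lintegral_finsetSum _ fun g _ => (hw g).mul_const _]
  refine Finset.sum_congr rfl fun g _ => ?_
  rw [setLIntegral_congr_fun (hE.measurableSet_graphEvent _) (hF n g), setLIntegral_const,
    hE.measure_graphEvent h0 h1, mul_comm]
  exact (lintegral_mul_const _ (hw g)).symm

theorem ofReal_add_ofReal_one_sub {t : ℝ} (h0 : 0 ≤ t) (h1 : t ≤ 1) :
    ENNReal.ofReal t + ENNReal.ofReal (1 - t) = 1 := by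
  rw [← ENNReal.ofReal_add h0 (by linarith)]; simp

/-- The expected number of isolated nodes. -/
theorem HasIndependentEdges.lintegral_numIsolated (hV : IsPoissonProcess P ν V)
    (hE : HasIndependentEdges P h V G X) (hm : Measurable (Function.uncurry h))
    (hs : ∀ x y, h x y = h y x) (h0 : ∀ x y, 0 ≤ h x y) (h1 : ∀ x y, h x y ≤ 1) :
    ∫⁻ ω, (numIsolated (V ω) (G ω) : ℝ≥0∞) ∂P =
      ∫⁻ a, ENNReal.ofReal (Real.exp ((∫⁻ y, ENNReal.ofReal (1 - h a y) ∂ν).toReal -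
        ν.real Set.univ)) ∂ν := by
  classical
  have hq' : Measurable (Function.uncurry fun x y => ENNReal.ofReal (1 - h x y)) :=
    (measurable_const.sub hm).ennreal_ofReal
  rw [← tsum_lintegral_isolatedSum hq' fun a b => by simp [h0 a b]]
  refine hE.lintegral_eq_tsum hV hm h0 h1
    (Φ := fun n g => ∑ i, if ∀ j, ¬ g.Adj i j then 1 else 0) (fun n g ω hω => ?_)
    (measurable_isolatedSum hq') (fun n => isolatedSum_comp _) (fun n x => ?_)
  · rw [numIsolated_eq_of_mem_graphEvent hE.bijOn_enum hω]; push_cast; rfl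
  · exact sum_graphWeight_mul_card_isolated (p := fun x y => ENNReal.ofReal (h x y))
      (q := fun x y => ENNReal.ofReal (1 - h x y)) (fun a b => by rw [hs])
      (fun a b => ofReal_add_ofReal_one_sub (h0 a b) (h1 a b)) x

/-- The second moment of the number of isolated nodes. -/
theorem HasIndependentEdges.lintegral_numIsolated_sq (hV : IsPoissonProcess P ν V)
    (hE : HasIndependentEdges P h V G X) (hm : Measurable (Function.uncurry h))
    (hs : ∀ x y, h x y = h y x) (h0 : ∀ x y, 0 ≤ h x y) (h1 : ∀ x y, h x y ≤ 1) :
    ∫⁻ ω, (numIsolated (V ω) (G ω) : ℝ≥0∞) ^ 2 ∂P =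
      ∫⁻ ω, (numIsolated (V ω) (G ω) : ℝ≥0∞) ∂P +
      ∫⁻ a, ∫⁻ b, ENNReal.ofReal (1 - h a b) * ENNReal.ofReal (Real.exp
        ((∫⁻ z, ENNReal.ofReal (1 - h a z) * ENNReal.ofReal (1 - h b z) ∂ν).toReal -
          ν.real Set.univ)) ∂ν ∂ν := by
  classical
  have hq' : Measurable (Function.uncurry fun x y => ENNReal.ofReal (1 - h x y)) :=
    (measurable_const.sub hm).ennreal_ofReal
  have hpq : ∀ a b, ENNReal.ofReal (h a b) + ENNReal.ofReal (1 - h a b) = 1 := fun a b =>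
    ofReal_add_ofReal_one_sub (h0 a b) (h1 a b)
  have hs' : ∀ a b, ENNReal.ofReal (1 - h a b) = ENNReal.ofReal (1 - h b a) := fun a b => by rw [hs]
  have h1' : ∀ a b, ENNReal.ofReal (1 - h a b) ≤ 1 := fun a b => by simp [h0 a b]
  rw [hE.lintegral_numIsolated hV hm hs h0 h1,
    ← tsum_lintegral_isolatedPairSum hq' h1', ← tsum_lintegral_isolatedSum hq' h1',
    ← ENNReal.tsum_add]
  simp only [← mul_add, ← lintegral_add_left (measurable_isolatedSum hq' _)]
  refine hE.lintegral_eq_tsum hV hm h0 h1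
    (Φ := fun n g => (∑ i, if ∀ j, ¬ g.Adj i j then 1 else 0) +
      ∑ i, ∑ j, if j = i then 0 else
          if (∀ k, ¬ g.Adj i k) ∧ (∀ k, ¬ g.Adj j k) then 1 else 0) (fun n g ω hω => ?_)
    (fun n => (measurable_isolatedSum hq' n).add (measurable_isolatedPairSum hq' n))
    (fun n σ x => by rw [isolatedSum_comp, isolatedPairSum_comp]) (fun n x => ?_)
  · rw [numIsolated_eq_of_mem_graphEvent hE.bijOn_enum hω]
    push_cast
    rw [sq, Finset.sum_mul_sum, ← Finset.sum_add_distrib]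
    refine Finset.sum_congr rfl fun i _ => ?_
    -- Splitting off the diagonal: N² = N + N(N - 1).
    have e : ∀ j, ((if ∀ k, ¬ g.Adj i k then 1 else 0 : ℝ≥0∞) *
        (if ∀ k, ¬ g.Adj j k then 1 else 0)) = (if j = i then
          (if ∀ k, ¬ g.Adj i k then 1 else 0) else 0) + (if j = i then 0 else
          if (∀ k, ¬ g.Adj i k) ∧ (∀ k, ¬ g.Adj j k) then 1 else 0) := fun j => by
      by_cases hji : j = i
      · subst hji; by_cases h1 : ∀ k, ¬ g.Adj j k <;> simp [h1]
      · by_cases h1 : ∀ k, ¬ g.Adj i k <;> by_cases h2 : ∀ k, ¬ g.Adj j k <;> simp [h1, h2, hji]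
    rw [Finset.sum_congr rfl fun j _ => e j, Finset.sum_add_distrib]
    simp
  · simp only [mul_add, Finset.sum_add_distrib]
    congr 1
    · exact sum_graphWeight_mul_card_isolated (p := fun x y => ENNReal.ofReal (h x y))
        (q := fun x y => ENNReal.ofReal (1 - h x y)) hs' hpq x
    · exact sum_graphWeight_mul_card_isolated_pairs (p := fun x y => ENNReal.ofReal (h x y))
        (q := fun x y => ENNReal.ofReal (1 - h x y)) hs' hpq x

/-- The expected sum of the degrees. -/
theorem HasIndependentEdges.lintegral_sum_degree (hV : IsPoissonProcess P ν V)
    (hE : HasIndependentEdges P h V G X) (hm : Measurable (Function.uncurry h))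
    (hs : ∀ x y, h x y = h y x) (h0 : ∀ x y, 0 ≤ h x y) (h1 : ∀ x y, h x y ≤ 1) :
    ∫⁻ ω, ((∑ x ∈ V ω, {y : E | y ∈ V ω ∧ (G ω).Adj x y}.ncard : ℕ) : ℝ≥0∞) ∂P =
      ∫⁻ a, ∫⁻ b, ENNReal.ofReal (h a b) ∂ν ∂ν := by
  classical
  have hp' : Measurable (Function.uncurry fun x y => ENNReal.ofReal (h x y)) := hm.ennreal_ofReal
  rw [← tsum_lintegral_adjacentSum hp']
  refine hE.lintegral_eq_tsum hV hm h0 h1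
    (Φ := fun n g => ∑ i, ∑ j, if g.Adj i j then 1 else 0) (fun n g ω hω => ?_)
    (measurable_adjacentSum hp') (fun n => adjacentSum_comp _) (fun n x => ?_)
  · rw [sum_degree_eq_of_mem_graphEvent hE.bijOn_enum hω]; push_cast; rfl
  · exact sum_graphWeight_mul_degrees (p := fun x y => ENNReal.ofReal (h x y))
      (q := fun x y => ENNReal.ofReal (1 - h x y)) (fun a b => by rw [hs])
      (fun a b => ofReal_add_ofReal_one_sub (h0 a b) (h1 a b)) x

end RandomGraph

/-! ### Moment bounds when every point has the same expected degree. -/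

section Homogeneous

variable {Ω E : Type*} [MeasurableSpace Ω] [MeasurableSpace E]
  {P : Measure Ω} {h : E → E → ℝ} {V : Ω → Finset E} {G : Ω → SimpleGraph E} {X : ℕ → Ω → E}
  {ν : Measure E} [IsFiniteMeasure ν] {d : ℝ}

theorem toReal_lintegral_one_sub (hm : Measurable (Function.uncurry h))
    (h0 : ∀ x y, 0 ≤ h x y) (h1 : ∀ x y, h x y ≤ 1) (hd0 : 0 ≤ d)
    (hd : ∀ a, ∫⁻ y, ENNReal.ofReal (h a y) ∂ν = ENNReal.ofReal d) (a : E) :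
    (∫⁻ y, ENNReal.ofReal (1 - h a y) ∂ν).toReal - ν.real Set.univ = -d := by
  have hma : Measurable fun y => h a y := hm.comp measurable_prodMk_left
  have e : ∫⁻ y, ENNReal.ofReal (h a y) ∂ν + ∫⁻ y, ENNReal.ofReal (1 - h a y) ∂ν = ν Set.univ := by
    rw [← lintegral_add_left hma.ennreal_ofReal]
    simp only [ofReal_add_ofReal_one_sub (h0 _ _) (h1 _ _), lintegral_one]
  have hfin : ∫⁻ y, ENNReal.ofReal (1 - h a y) ∂ν ≠ ⊤ :=
    lintegral_ne_top_of_le_one fun y => by simp [h0 a y]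
  rw [hd] at e
  rw [measureReal_def, ← e, ENNReal.toReal_add ENNReal.ofReal_ne_top hfin, ENNReal.toReal_ofReal hd0]
  ring

/-- This is (1 - x)(1 - y) = 1 - x - y + xy integrated, arranged additively so that no subtraction
occurs in `ℝ≥0∞`. The last term is the mean number of common neighbours, the only source of
correlation. -/
theorem toReal_lintegral_one_sub_mul (hm : Measurable (Function.uncurry h))
    (h0 : ∀ x y, 0 ≤ h x y) (h1 : ∀ x y, h x y ≤ 1) (hd0 : 0 ≤ d)
    (hd : ∀ a, ∫⁻ y, ENNReal.ofReal (h a y) ∂ν = ENNReal.ofReal d) (a b : E) :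
    (∫⁻ z, ENNReal.ofReal (1 - h a z) * ENNReal.ofReal (1 - h b z) ∂ν).toReal - ν.real Set.univ =
      -(2 * d) + (∫⁻ z, ENNReal.ofReal (h a z) * ENNReal.ofReal (h b z) ∂ν).toReal := by
  have hma : ∀ a, Measurable fun y => h a y := fun a => hm.comp measurable_prodMk_left
  have e : ∫⁻ y, ENNReal.ofReal (h a y) ∂ν + (∫⁻ y, ENNReal.ofReal (h b y) ∂ν +
      ∫⁻ z, ENNReal.ofReal (1 - h a z) * ENNReal.ofReal (1 - h b z) ∂ν) =
      ν Set.univ + ∫⁻ z, ENNReal.ofReal (h a z) * ENNReal.ofReal (h b z) ∂ν := by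
    rw [← lintegral_one, ← lintegral_add_left (hma b).ennreal_ofReal,
      ← lintegral_add_left (hma a).ennreal_ofReal, ← lintegral_add_left measurable_const]
    refine lintegral_congr fun z => ?_
    have ha0 := h0 a z
    have hb0 := h0 b z
    have ha1 : 0 ≤ 1 - h a z := sub_nonneg.2 (h1 a z)
    have hb1 : 0 ≤ 1 - h b z := sub_nonneg.2 (h1 b z)
    rw [← ENNReal.ofReal_mul ha0, ← ENNReal.ofReal_mul ha1,
      ← ENNReal.ofReal_add hb0 (by positivity), ← ENNReal.ofReal_add ha0 (by positivity),
      ← ENNReal.ofReal_one, ← ENNReal.ofReal_add zero_le_one (by positivity)]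
    congr 1; ring
  have hfin : ∫⁻ z, ENNReal.ofReal (1 - h a z) * ENNReal.ofReal (1 - h b z) ∂ν ≠ ⊤ :=
    lintegral_ne_top_of_le_one fun z => mul_le_one' (by simp [h0 a z]) (by simp [h0 b z])
  have hfin' : ∫⁻ z, ENNReal.ofReal (h a z) * ENNReal.ofReal (h b z) ∂ν ≠ ⊤ :=
    lintegral_ne_top_of_le_one fun z => mul_le_one' (by simp [h1 a z]) (by simp [h1 b z])
  rw [hd, hd] at e
  have := congrArg ENNReal.toReal e
  rw [ENNReal.toReal_add ENNReal.ofReal_ne_top (ENNReal.add_ne_top.2 ⟨ENNReal.ofReal_ne_top, hfin⟩),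
    ENNReal.toReal_add ENNReal.ofReal_ne_top hfin, ENNReal.toReal_ofReal hd0,
    ENNReal.toReal_add (measure_ne_top _ _) hfin'] at this
  rw [measureReal_def]
  linarith

/-- By Tonelli one integrates over b first, with z fixed; symmetry of h gives one factor d, and the
integral over z gives the other. -/
theorem lintegral_lintegral_common (hm : Measurable (Function.uncurry h))
    (hs : ∀ x y, h x y = h y x)
    (hd : ∀ a, ∫⁻ y, ENNReal.ofReal (h a y) ∂ν = ENNReal.ofReal d) :
    ∫⁻ a, ∫⁻ b, ∫⁻ z, ENNReal.ofReal (h a z) * ENNReal.ofReal (h b z) ∂ν ∂ν ∂ν =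
      ν Set.univ * ENNReal.ofReal d ^ 2 := by
  have hma : ∀ a, Measurable fun y => h a y := fun a => hm.comp measurable_prodMk_left
  have e : ∀ a, ∫⁻ b, ∫⁻ z, ENNReal.ofReal (h a z) * ENNReal.ofReal (h b z) ∂ν ∂ν =
      ENNReal.ofReal d ^ 2 := fun a => by
    rw [lintegral_lintegral_swap]
    · have : ∀ z, ∫⁻ b, ENNReal.ofReal (h a z) * ENNReal.ofReal (h b z) ∂ν =
          ENNReal.ofReal (h a z) * ENNReal.ofReal d := fun z => by
        simp only [hs _ z]
        rw [lintegral_const_mul _ (hma z).ennreal_ofReal, hd]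
      simp only [this]
      rw [lintegral_mul_const _ (hma a).ennreal_ofReal, hd, sq]
    · refine Measurable.aemeasurable ?_
      exact ((hma a).comp measurable_snd).ennreal_ofReal.mul hm.ennreal_ofReal
  simp only [e, lintegral_const, mul_comm]

/-- The correlation factor exp(c) is replaced by 1 + c exp(d), which is linear in c and so can be
integrated exactly. The loss exp(d) is affordable because only one factor of the total mass
accompanies it. -/
theorem lintegral_pair_correlation_le (hm : Measurable (Function.uncurry h))
    (hs : ∀ x y, h x y = h y x) (h0 : ∀ x y, 0 ≤ h x y) (h1 : ∀ x y, h x y ≤ 1) (hd0 : 0 ≤ d)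
    (hd : ∀ a, ∫⁻ y, ENNReal.ofReal (h a y) ∂ν = ENNReal.ofReal d) :
    ∫⁻ a, ∫⁻ b, ENNReal.ofReal (1 - h a b) * ENNReal.ofReal (Real.exp
        ((∫⁻ z, ENNReal.ofReal (1 - h a z) * ENNReal.ofReal (1 - h b z) ∂ν).toReal -
          ν.real Set.univ)) ∂ν ∂ν ≤
      ENNReal.ofReal (Real.exp (-(2 * d)) *
        (ν.real Set.univ ^ 2 + Real.exp d * ν.real Set.univ * d ^ 2)) := by
  set C : E → E → ℝ≥0∞ := fun a b => ∫⁻ z, ENNReal.ofReal (h a z) * ENNReal.ofReal (h b z) ∂ν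
    with hC
  have hma : ∀ a, Measurable fun y => h a y := fun a => hm.comp measurable_prodMk_left
  have hCm : Measurable (Function.uncurry C) := by
    refine Measurable.lintegral_prod_right'
      (f := fun w : (E × E) × E => ENNReal.ofReal (h w.1.1 w.2) * ENNReal.ofReal (h w.1.2 w.2)) ?_
    exact (hm.comp (measurable_fst.fst.prodMk measurable_snd)).ennreal_ofReal.mul
      (hm.comp (measurable_fst.snd.prodMk measurable_snd)).ennreal_ofReal
  have hCd : ∀ a b, C a b ≤ ENNReal.ofReal d := fun a b => by
    rw [← hd a]
    refine lintegral_mono fun z => mul_le_of_le_one_right' ?_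
    simp [h1 b z]
  have key : ∀ a b, ENNReal.ofReal (1 - h a b) * ENNReal.ofReal (Real.exp
        ((∫⁻ z, ENNReal.ofReal (1 - h a z) * ENNReal.ofReal (1 - h b z) ∂ν).toReal -
          ν.real Set.univ)) ≤
      ENNReal.ofReal (Real.exp (-(2 * d))) * (1 + ENNReal.ofReal (Real.exp d) * C a b) := by
    intro a b
    have hfin : C a b ≠ ⊤ := ((hCd a b).trans_lt ENNReal.ofReal_lt_top).ne
    rw [toReal_lintegral_one_sub_mul hm h0 h1 hd0 hd]
    change _ * ENNReal.ofReal (Real.exp (-(2 * d) + (C a b).toReal)) ≤ _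
    refine (mul_le_of_le_one_left' (by simp [h0 a b])).trans ?_
    rw [← ENNReal.ofReal_toReal hfin]
    have hc0 : 0 ≤ (C a b).toReal := ENNReal.toReal_nonneg
    have hcd : (C a b).toReal ≤ d := ENNReal.toReal_le_of_le_ofReal hd0 (hCd a b)
    rw [ENNReal.toReal_ofReal hc0]
    generalize (C a b).toReal = c at hc0 hcd
    rw [← ENNReal.ofReal_mul (by positivity), ← ENNReal.ofReal_one,
      ← ENNReal.ofReal_add zero_le_one (by positivity), ← ENNReal.ofReal_mul (by positivity),
      Real.exp_add]
    refine ENNReal.ofReal_le_ofReal (mul_le_mul_of_nonneg_left ?_ (by positivity))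
    -- From here exp(c) ≤ 1 + c exp(c) ≤ 1 + c exp(d), the last step by c ≤ d.
    have h2 : 1 - c ≤ Real.exp (-c) := by linarith [Real.add_one_le_exp (-c)]
    have h3 : (1 - c) * Real.exp c ≤ 1 := by
      calc (1 - c) * Real.exp c ≤ Real.exp (-c) * Real.exp c := by gcongr
        _ = 1 := by rw [← Real.exp_add]; simp
    have h4 : c * Real.exp c ≤ c * Real.exp d := by gcongr
    nlinarith
  refine (lintegral_mono fun a => lintegral_mono fun b => key a b).trans ?_
  have hCa : ∀ a, Measurable fun b => C a b := fun a => hCm.comp measurable_prodMk_left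
  have e1 : ∀ a, ∫⁻ b, ENNReal.ofReal (Real.exp (-(2 * d))) *
      (1 + ENNReal.ofReal (Real.exp d) * C a b) ∂ν = ENNReal.ofReal (Real.exp (-(2 * d))) *
      (ν Set.univ + ENNReal.ofReal (Real.exp d) * ∫⁻ b, C a b ∂ν) := fun a => by
    rw [lintegral_const_mul _ (((hCa a).const_mul _).const_add _), lintegral_add_left
      measurable_const, lintegral_const_mul _ (hCa a), lintegral_one]
  simp only [e1]
  have hCi : Measurable fun a => ∫⁻ b, C a b ∂ν := hCm.lintegral_prod_right'
  rw [lintegral_const_mul _ ((hCi.const_mul _).const_add _), lintegral_add_left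
      measurable_const, lintegral_const_mul _ hCi, lintegral_lintegral_common hm hs hd,
    lintegral_const, ← ENNReal.ofReal_toReal (measure_ne_top ν Set.univ), ← measureReal_def,
    ← ENNReal.ofReal_pow hd0, ← ENNReal.ofReal_mul (by positivity),
    ← ENNReal.ofReal_mul (by positivity), ← ENNReal.ofReal_mul (by positivity),
    ← ENNReal.ofReal_add (by positivity) (by positivity), ← ENNReal.ofReal_mul (by positivity)]
  refine ENNReal.ofReal_le_ofReal (le_of_eq ?_)
  ring

variable [TopologicalSpace E] [T2Space E] [SecondCountableTopology E] [BorelSpace E]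

theorem HasIndependentEdges.lintegral_numIsolated_homogeneous (hV : IsPoissonProcess P ν V)
    (hE : HasIndependentEdges P h V G X) (hm : Measurable (Function.uncurry h))
    (hs : ∀ x y, h x y = h y x) (h0 : ∀ x y, 0 ≤ h x y) (h1 : ∀ x y, h x y ≤ 1) (hd0 : 0 ≤ d)
    (hd : ∀ a, ∫⁻ y, ENNReal.ofReal (h a y) ∂ν = ENNReal.ofReal d) :
    ∫⁻ ω, (numIsolated (V ω) (G ω) : ℝ≥0∞) ∂P =
      ENNReal.ofReal (ν.real Set.univ * Real.exp (-d)) := by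
  rw [hE.lintegral_numIsolated hV hm hs h0 h1]
  simp only [toReal_lintegral_one_sub hm h0 h1 hd0 hd, lintegral_const]
  rw [mul_comm, ENNReal.ofReal_mul measureReal_nonneg, measureReal_def,
    ENNReal.ofReal_toReal (measure_ne_top _ _)]

variable [IsProbabilityMeasure P]

/-- First moment bound. -/
theorem HasIndependentEdges.one_sub_le_prob_numIsolated_eq_zero (hV : IsPoissonProcess P ν V)
    (hE : HasIndependentEdges P h V G X) (hm : Measurable (Function.uncurry h))
    (hs : ∀ x y, h x y = h y x) (h0 : ∀ x y, 0 ≤ h x y) (h1 : ∀ x y, h x y ≤ 1) (hd0 : 0 ≤ d)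
    (hd : ∀ a, ∫⁻ y, ENNReal.ofReal (h a y) ∂ν = ENNReal.ofReal d) :
    1 - ν.real Set.univ * Real.exp (-d) ≤ P.real {ω | numIsolated (V ω) (G ω) = 0} := by
  have hNm := hE.measurable_numIsolated
  have hA : MeasurableSet {ω | numIsolated (V ω) (G ω) = 0} := hNm (measurableSet_singleton 0)
  have hle : P {ω | numIsolated (V ω) (G ω) = 0}ᶜ ≤
      ENNReal.ofReal (ν.real Set.univ * Real.exp (-d)) := by
    rw [← hE.lintegral_numIsolated_homogeneous hV hm hs h0 h1 hd0 hd,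
      ← lintegral_indicator_one hA.compl]
    -- Markov's inequality: the indicator of N ≠ 0 is at most N.
    refine lintegral_mono fun ω => ?_
    by_cases hω : numIsolated (V ω) (G ω) = 0
    · simp [hω]
    · simp [hω, Nat.one_le_iff_ne_zero]
  have := ENNReal.toReal_le_of_le_ofReal (by positivity) hle
  rw [← measureReal_def, probReal_compl_eq_one_sub hA] at this
  linarith

/-- Second moment bound. -/
theorem HasIndependentEdges.prob_numIsolated_eq_zero_le (hV : IsPoissonProcess P ν V)
    (hE : HasIndependentEdges P h V G X) (hm : Measurable (Function.uncurry h))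
    (hs : ∀ x y, h x y = h y x) (h0 : ∀ x y, 0 ≤ h x y) (h1 : ∀ x y, h x y ≤ 1) (hd0 : 0 ≤ d)
    (hd : ∀ a, ∫⁻ y, ENNReal.ofReal (h a y) ∂ν = ENNReal.ofReal d)
    (hν : 0 < ν.real Set.univ) :
    P.real {ω | numIsolated (V ω) (G ω) = 0} ≤ (1 + d ^ 2) * Real.exp d / ν.real Set.univ := by
  set L := ν.real Set.univ with hL
  set M := L * Real.exp (-d) with hM
  have hM0 : 0 < M := by positivity
  have hNm := hE.measurable_numIsolated
  have hNm' : Measurable fun ω => (numIsolated (V ω) (G ω) : ℝ≥0∞) :=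
    (measurable_of_countable (fun n : ℕ => (n : ℝ≥0∞))).comp hNm
  have hA : MeasurableSet {ω | numIsolated (V ω) (G ω) = 0} := hNm (measurableSet_singleton 0)
  have hE1 := hE.lintegral_numIsolated_homogeneous hV hm hs h0 h1 hd0 hd
  have hE2 := hE.lintegral_numIsolated_sq hV hm hs h0 h1
  -- Chebyshev's inequality M² 1{N = 0} ≤ (N - M)², with the cross term moved to the left to stay
  -- within `ℝ≥0∞`.
  have hpt : ∀ ω, ENNReal.ofReal (M ^ 2) *
        {ω | numIsolated (V ω) (G ω) = 0}.indicator 1 ω +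
      ENNReal.ofReal (2 * M) * (numIsolated (V ω) (G ω) : ℝ≥0∞) ≤
      (numIsolated (V ω) (G ω) : ℝ≥0∞) ^ 2 + ENNReal.ofReal (M ^ 2) := fun ω => by
    by_cases hω : numIsolated (V ω) (G ω) = 0
    · simp [hω]
    · simp only [Set.indicator, Set.mem_ofPred_eq, hω, if_false, mul_zero, zero_add]
      rw [← ENNReal.ofReal_natCast, ← ENNReal.ofReal_mul (by positivity),
        ← ENNReal.ofReal_pow (by positivity), ← ENNReal.ofReal_add (by positivity) (by positivity)]
      refine ENNReal.ofReal_le_ofReal ?_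
      nlinarith [sq_nonneg ((numIsolated (V ω) (G ω) : ℝ) - M)]
  have hint := lintegral_mono (μ := P) hpt
  rw [lintegral_add_right _ (hNm'.const_mul _), lintegral_const_mul _ hNm',
    lintegral_const_mul _ (measurable_one.indicator hA), lintegral_indicator_one hA,
    lintegral_add_right _ measurable_const, hE2, hE1, lintegral_const, measure_univ, mul_one] at hint
  have hint2 := hint.trans (add_le_add_left (add_le_add_right
    (lintegral_pair_correlation_le hm hs h0 h1 hd0 hd) _) _)
  rw [← ENNReal.ofReal_toReal (measure_ne_top P _), ← measureReal_def,
    ← ENNReal.ofReal_mul (by positivity), ← ENNReal.ofReal_mul (by positivity),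
    ← ENNReal.ofReal_add (by positivity) (by positivity),
    ← ENNReal.ofReal_add (by positivity) (by positivity),
    ← ENNReal.ofReal_add (by positivity) (by positivity),
    ENNReal.ofReal_le_ofReal_iff (by positivity)] at hint2
  set p := P.real {ω | numIsolated (V ω) (G ω) = 0}
  have hexp : Real.exp (-(2 * d)) * (L ^ 2 + Real.exp d * L * d ^ 2) = M ^ 2 + M * d ^ 2 := by
    have e2 : Real.exp (-(2 * d)) = Real.exp (-d) * Real.exp (-d) := by
      rw [← Real.exp_add]; congr 1; ring
    have e3 : Real.exp (-d) * Real.exp d = 1 := by rw [← Real.exp_add]; simp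
    rw [e2, hM]
    linear_combination (Real.exp (-d) * L * d ^ 2) * e3
  rw [← hL, hexp] at hint2
  -- The M² terms cancel in M² p + 2M² ≤ M + (M² + M d²) + M², and a factor M is divided out.
  have hfin : p * M ≤ 1 + d ^ 2 := by
    have : M * (p * M) ≤ M * (1 + d ^ 2) := by
      change M ^ 2 * p + 2 * M * M ≤ M + (M ^ 2 + M * d ^ 2) + M ^ 2 at hint2
      linarith
    exact le_of_mul_le_mul_left this hM0
  rw [le_div_iff₀ hν]
  have e3 : Real.exp (-d) * Real.exp d = 1 := by rw [← Real.exp_add]; simp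
  calc p * L = p * M * Real.exp d := by rw [hM]; linear_combination -(p * L) * e3
    _ ≤ (1 + d ^ 2) * Real.exp d := by gcongr

end Homogeneous

/-! ### Expected degree on the circle and asymptotics. -/

section Circle

variable {H : ℝ → ℝ}

/-- `H` is controlled only on [0, ∞), so its compositions must factor through `ℝ≥0`. -/
theorem measurable_comp_of_nonneg {α : Type*} [MeasurableSpace α]
    (hH : Measurable fun r : ℝ≥0 => H r) {f : α → ℝ} (hf : Measurable f) (h0 : ∀ x, 0 ≤ f x) :
    Measurable fun x => H (f x) :=
  hH.comp (hf.subtype_mk (h := h0))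

theorem ofReal_integral_of_mem_unitInterval {α : Type*} [MeasurableSpace α] {μ : Measure α}
    [IsFiniteMeasure μ] {f : α → ℝ} (hf : Measurable f) (h0 : ∀ x, 0 ≤ f x) (h1 : ∀ x, f x ≤ 1) :
    ENNReal.ofReal (∫ x, f x ∂μ) = ∫⁻ x, ENNReal.ofReal (f x) ∂μ :=
  ofReal_integral_eq_lintegral_ofReal
    (Integrable.of_bound hf.aestronglyMeasurable 1 (Eventually.of_forall fun x => by
      rw [Real.norm_of_nonneg (h0 x)]; exact h1 x)) (Eventually.of_forall h0)

theorem scaledConnection_symm (R L : ℝ) (x y : AddCircle L) :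
    scaledConnection H R L x y = scaledConnection H R L y x := by
  rw [scaledConnection, scaledConnection, norm_sub_rev]

theorem scaledConnection_eq_zero_sub (R L : ℝ) (x y : AddCircle L) :
    scaledConnection H R L x y = scaledConnection H R L 0 (x - y) := by
  rw [scaledConnection, scaledConnection, zero_sub, norm_neg]

theorem measurable_scaledConnection (hH : Measurable fun r : ℝ≥0 => H r) {R : ℝ} (hR : 0 ≤ R)
    (L : ℝ) : Measurable (Function.uncurry (scaledConnection H R L)) :=
  measurable_comp_of_nonneg hH (f := fun p : AddCircle L × AddCircle L => ‖p.1 - p.2‖ / R)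
    (by fun_prop) (fun p => by positivity)

/-- The circle is cut open at the antipode of 0, to [-L/2, L/2], where the circular norm is |a|. The
two half circles give the factor 2, and scaling by R gives the rest. -/
theorem integral_scaledConnection (hH : Measurable fun r : ℝ≥0 => H r)
    (h01 : ∀ r, 0 ≤ r → 0 ≤ H r ∧ H r ≤ 1) {R : ℝ} (hR : 0 < R) (L : ℝ) [hL : Fact (0 < L)] :
    ∫ z : AddCircle L, scaledConnection H R L 0 z = 2 * R * ∫ r in 0..L / (2 * R), H r := by
  have hL0 := hL.out
  rw [← AddCircle.intervalIntegral_preimage L (-(L / 2))]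
  have e1 : -(L / 2) + L = L / 2 := by ring
  rw [e1]
  have e2 : ∫ a in -(L / 2)..L / 2, scaledConnection H R L 0 (a : AddCircle L) =
      ∫ a in -(L / 2)..L / 2, H (|a| / R) := by
    refine intervalIntegral.integral_congr fun a ha => ?_
    rw [Set.uIcc_of_le (by linarith)] at ha
    simp only [scaledConnection, zero_sub, norm_neg]
    rw [(AddCircle.norm_coe_eq_abs_iff L hL0.ne').2]
    rw [abs_of_pos hL0]
    exact abs_le.2 ha
  have hm : Measurable fun a : ℝ => H (|a| / R) :=
    measurable_comp_of_nonneg hH (by fun_prop) fun a => by positivity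
  have hi : ∀ s t, IntervalIntegrable (fun a : ℝ => H (|a| / R)) volume s t := fun s t =>
    (intervalIntegrable_const (c := (1 : ℝ))).mono_fun hm.aestronglyMeasurable
      (Eventually.of_forall fun a => by
        have := h01 (|a| / R) (by positivity)
        dsimp only
        rw [Real.norm_of_nonneg this.1]; simpa using this.2)
  have e3 : ∫ a in -(L / 2)..0, H (|a| / R) = ∫ a in 0..L / 2, H (|a| / R) := by
    have := intervalIntegral.integral_comp_neg (a := 0) (b := L / 2) fun a => H (|a| / R)
    simp only [abs_neg, neg_zero] at this
    exact this.symm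
  have e4 : ∫ a in 0..L / 2, H (|a| / R) = R * ∫ r in 0..L / (2 * R), H r := by
    have : ∫ a in 0..L / 2, H (|a| / R) = ∫ a in 0..L / 2, H (a / R) := by
      refine intervalIntegral.integral_congr fun a ha => ?_
      rw [Set.uIcc_of_le (by linarith)] at ha
      simp only [abs_of_nonneg ha.1]
    rw [this, intervalIntegral.integral_comp_div _ hR.ne']
    simp [div_div]
  rw [e2, ← intervalIntegral.integral_add_adjacent_intervals (hi _ 0) (hi 0 _), e3, e4]
  ring

/-- Invariance of Haar measure under y ↦ x - y; it supplies the homogeneity hypothesis of the moment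
bounds. -/
theorem lintegral_scaledConnection (hH : Measurable fun r : ℝ≥0 => H r)
    (h01 : ∀ r, 0 ≤ r → 0 ≤ H r ∧ H r ≤ 1) {R : ℝ} (hR : 0 < R) (L : ℝ) [hL : Fact (0 < L)]
    (x : AddCircle L) :
    ∫⁻ y, ENNReal.ofReal (scaledConnection H R L x y) =
      ENNReal.ofReal (∫ z : AddCircle L, scaledConnection H R L 0 z) := by
  have h0 : ∀ y z, 0 ≤ scaledConnection H R L y z := fun y z => (h01 _ (by positivity)).1
  have h1 : ∀ y z, scaledConnection H R L y z ≤ 1 := fun y z => (h01 _ (by positivity)).2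
  have hm : Measurable fun z => scaledConnection H R L 0 z :=
    measurable_comp_of_nonneg hH (f := fun z : AddCircle L => ‖0 - z‖ / R) (by fun_prop)
      fun z => by positivity
  rw [ofReal_integral_of_mem_unitInterval hm (h0 0) (h1 0)]
  have e : ∀ y, scaledConnection H R L x y = scaledConnection H R L 0 (x - y) :=
    scaledConnection_eq_zero_sub R L x
  simp only [e]
  exact lintegral_sub_left_eq_self
    (fun z : AddCircle L => ENNReal.ofReal (scaledConnection H R L 0 z)) x

theorem tendsto_div_log_atTop : Tendsto (fun L : ℝ => L / Real.log L) atTop atTop := by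
  have h := (Real.tendsto_exp_div_pow_atTop 1).comp Real.tendsto_log_atTop
  refine h.congr' ?_
  filter_upwards [eventually_gt_atTop 0] with L hL
  simp [Real.exp_log hL]

/-- The connection range γ ln L is negligible against L, so the truncation point L / (2γ ln L) tends
to infinity and the full integral of H appears. -/
theorem tendsto_expectedDegree_div_log (hH : IntegrableOn H (Set.Ioi 0)) {γ : ℝ} (hγ : 0 < γ) :
    Tendsto (fun L => 2 * (γ * Real.log L) *
        (∫ r in 0..L / (2 * (γ * Real.log L)), H r) / Real.log L) atTop
      (𝓝 (2 * γ * ∫ r in Set.Ioi 0, H r)) := by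
  have h1 : Tendsto (fun L : ℝ => L / (2 * (γ * Real.log L))) atTop atTop := by
    refine (tendsto_div_log_atTop.const_mul_atTop (show 0 < (2 * γ)⁻¹ by positivity)).congr
      fun L => ?_
    rw [← mul_assoc 2 γ, ← div_div, div_right_comm]
    ring
  have h2 := (intervalIntegral_tendsto_integral_Ioi 0 hH h1).const_mul (2 * γ)
  refine h2.congr' ?_
  filter_upwards [eventually_gt_atTop 1] with L hL
  have := Real.log_pos hL
  field_simp

theorem tendsto_rpow_neg_mul_log_sq {b : ℝ} (hb : 0 < b) (c : ℝ) :
    Tendsto (fun L : ℝ => (1 + (c * Real.log L) ^ 2) * L ^ (-b)) atTop (𝓝 0) := by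
  have h1 : Tendsto (fun L : ℝ => L ^ (-b)) atTop (𝓝 0) := tendsto_rpow_neg_atTop hb
  have h2 : Tendsto (fun L : ℝ => Real.log L ^ (2 : ℝ) / L ^ b) atTop (𝓝 0) :=
    (isLittleO_log_rpow_rpow_atTop 2 hb).tendsto_div_nhds_zero
  have h3 := h1.add (h2.const_mul (c ^ 2))
  rw [mul_zero, add_zero] at h3
  refine h3.congr' ?_
  filter_upwards [eventually_gt_atTop 0] with L hL
  rw [Real.rpow_neg hL.le, Real.rpow_two]
  ring

end Circle

/-! ### The threshold. -/

theorem mainTheorem1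
    (H : ℝ → ℝ)
    (hH_meas : Measurable fun r : ℝ≥0 => H r)
    (hH_range : ∀ r : ℝ, 0 ≤ r → 0 ≤ H r ∧ H r ≤ 1)
    (hH_int : IntegrableOn H (Set.Ioi 0))
    (γ : ℝ) (hγ : 0 < γ)
    {Ω : ℝ → Type*} [∀ L, MeasurableSpace (Ω L)]
    (P : ∀ L, Measure (Ω L)) [∀ L, IsProbabilityMeasure (P L)]
    (V : ∀ L, Ω L → Finset (AddCircle L))
    (G : ∀ L, Ω L → SimpleGraph (AddCircle L))
    (hG : ∀ (L : ℝ) [Fact (0 < L)], 1 < L →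
      IsSoftRGG (P L) L (scaledConnection H (γ * Real.log L) L) (V L) (G L)) :
    (2 * γ * (∫ r in Set.Ioi 0, H r) < 1 →
      Tendsto (fun L => (P L).real {ω | numIsolated (V L ω) (G L ω) = 0}) atTop (𝓝 0)) ∧
    (1 < 2 * γ * (∫ r in Set.Ioi 0, H r) →
      Tendsto (fun L => (P L).real {ω | numIsolated (V L ω) (G L ω) = 0}) atTop (𝓝 1)) ∧
    (∀ (L : ℝ) [Fact (0 < L)], 1 < L →
      meanDegree (P L) (V L) (G L) =
        ENNReal.ofReal (∫ z : AddCircle L, scaledConnection H (γ * Real.log L) L 0 z)) ∧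
    Tendsto (fun L => (meanDegree (P L) (V L) (G L)).toReal / Real.log L) atTop
      (𝓝 (2 * γ * ∫ r in Set.Ioi 0, H r)) := by
  set κ := 2 * γ * ∫ r in Set.Ioi 0, H r with hκ
  set d : ℝ → ℝ := fun L => 2 * (γ * Real.log L) * ∫ r in 0..L / (2 * (γ * Real.log L)), H r
    with hd
  have hdlim : Tendsto (fun L => d L / Real.log L) atTop (𝓝 κ) :=
    tendsto_expectedDegree_div_log hH_int hγ
  have hR : ∀ L : ℝ, 1 < L → 0 < γ * Real.log L := fun L hL => mul_pos hγ (Real.log_pos hL)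
  have h0 : ∀ L : ℝ, 1 < L → ∀ x y, 0 ≤ scaledConnection H (γ * Real.log L) L x y :=
    fun L hL x y => (hH_range _ (div_nonneg (norm_nonneg _) (hR L hL).le)).1
  have h1 : ∀ L : ℝ, 1 < L → ∀ x y, scaledConnection H (γ * Real.log L) L x y ≤ 1 :=
    fun L hL x y => (hH_range _ (div_nonneg (norm_nonneg _) (hR L hL).le)).2
  have hdint : ∀ (L : ℝ) [Fact (0 < L)], 1 < L →
      ∫ z : AddCircle L, scaledConnection H (γ * Real.log L) L 0 z = d L := fun L _ hL =>
    integral_scaledConnection hH_meas hH_range (hR L hL) L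
  have hd0 : ∀ L : ℝ, 1 < L → 0 ≤ d L := fun L hL => by
    have : Fact (0 < L) := ⟨by linarith⟩
    rw [← hdint L hL]
    exact integral_nonneg (h0 L hL 0)
  have hdl : ∀ (L : ℝ) [Fact (0 < L)], 1 < L → ∀ x,
      ∫⁻ y, ENNReal.ofReal (scaledConnection H (γ * Real.log L) L x y) = ENNReal.ofReal (d L) :=
    fun L _ hL x => by
      rw [lintegral_scaledConnection hH_meas hH_range (hR L hL) L x, hdint L hL]
  have hvol : ∀ (L : ℝ) [hL : Fact (0 < L)],
      (volume : Measure (AddCircle L)).real Set.univ = L := fun L hL => by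
    rw [measureReal_def, AddCircle.measure_univ, ENNReal.toReal_ofReal hL.out.le]
  have hdeg : ∀ (L : ℝ) [Fact (0 < L)], 1 < L →
      meanDegree (P L) (V L) (G L) = ENNReal.ofReal (d L) := fun L hF hL => by
    obtain ⟨hV, X, hE⟩ := hG L hL
    rw [meanDegree, hE.lintegral_sum_degree hV (measurable_scaledConnection hH_meas (hR L hL).le L)
      (scaledConnection_symm _ _) (h0 L hL) (h1 L hL), hV.lintegral_card]
    simp only [hdl L hL, lintegral_const]
    -- The expected degree sum is d L and the expected number of nodes is L.
    refine ENNReal.mul_div_cancel_right ?_ (measure_ne_top _ _)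
    rw [AddCircle.measure_univ]
    simpa using hF.out
  have hupper : ∀ L : ℝ, 1 < L → (P L).real {ω | numIsolated (V L ω) (G L ω) = 0} ≤
      (1 + d L ^ 2) * Real.exp (d L) / L := fun L hL => by
    have : Fact (0 < L) := ⟨by linarith⟩
    obtain ⟨hV, X, hE⟩ := hG L hL
    have := hE.prob_numIsolated_eq_zero_le hV
      (measurable_scaledConnection hH_meas (hR L hL).le L)
      (scaledConnection_symm _ _) (h0 L hL) (h1 L hL) (hd0 L hL) (hdl L hL)
      (by rw [hvol]; linarith)
    rwa [hvol] at this
  have hlower : ∀ L : ℝ, 1 < L → 1 - L * Real.exp (-d L) ≤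
      (P L).real {ω | numIsolated (V L ω) (G L ω) = 0} := fun L hL => by
    have : Fact (0 < L) := ⟨by linarith⟩
    obtain ⟨hV, X, hE⟩ := hG L hL
    have := hE.one_sub_le_prob_numIsolated_eq_zero hV
      (measurable_scaledConnection hH_meas (hR L hL).le L)
      (scaledConnection_symm _ _) (h0 L hL) (h1 L hL) (hd0 L hL) (hdl L hL)
    rwa [hvol] at this
  refine ⟨fun hlt => ?_, fun hgt => ?_, fun L _ hL => ?_, ?_⟩
  -- With κ < c < 1, eventually d ≤ c ln L, and the second moment bound is at most (1 + (c ln L)²)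
  -- L^(c - 1).
  · obtain ⟨c, hκc, hc1⟩ := exists_between hlt
    refine squeeze_zero' (Eventually.of_forall fun L => measureReal_nonneg) ?_
      (tendsto_rpow_neg_mul_log_sq (sub_pos.2 hc1) c)
    filter_upwards [eventually_gt_atTop 1, hdlim.eventually_lt_const hκc] with L hL hdL
    have hL0 : 0 < L := by linarith
    have hdc : d L ≤ c * Real.log L := ((div_lt_iff₀ (Real.log_pos hL)).1 hdL).le
    have hd0L := hd0 L hL
    have e : L ^ (-(1 - c)) = Real.exp (c * Real.log L) / L := by
      rw [neg_sub, Real.rpow_sub hL0, Real.rpow_one, Real.rpow_def_of_pos hL0, mul_comm c]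
    refine (hupper L hL).trans ?_
    rw [e, mul_div_assoc]
    gcongr
  -- With 1 < c < κ, eventually d ≥ c ln L, so the expected number of isolated nodes is at most L^(1
  -- - c).
  · obtain ⟨c, hc1, hcκ⟩ := exists_between hgt
    have hlim : Tendsto (fun L : ℝ => 1 - L ^ (-(c - 1))) atTop (𝓝 1) := by
      simpa using (tendsto_rpow_neg_atTop (sub_pos.2 hc1)).const_sub 1
    refine tendsto_of_tendsto_of_tendsto_of_le_of_le' hlim tendsto_const_nhds ?_
      (Eventually.of_forall fun L => measureReal_le_one)
    filter_upwards [eventually_gt_atTop 1, hdlim.eventually_const_lt hcκ] with L hL hdL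
    have hL0 : 0 < L := by linarith
    have hdc : c * Real.log L ≤ d L := ((lt_div_iff₀ (Real.log_pos hL)).1 hdL).le
    have e : L ^ (-(c - 1)) = L * Real.exp (-(c * Real.log L)) := by
      rw [neg_sub, sub_eq_add_neg, Real.rpow_add hL0, Real.rpow_one, Real.rpow_def_of_pos hL0]
      congr 2; ring
    refine le_trans ?_ (hlower L hL)
    rw [e]
    gcongr
  · rw [hdeg L hL, hdint L hL]
  · refine hdlim.congr' ?_
    filter_upwards [eventually_gt_atTop 1] with L hL
    have : Fact (0 < L) := ⟨by linarith⟩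
    rw [hdeg L hL, ENNReal.toReal_ofReal (hd0 L hL)]
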